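/- Let $(\mathcal C,\mathbb E,\mathfrak s)$ be an extriangulated category (in the sense of Nakaoka and Palu) with enough projectives and enough injectives, whose underlying additive category $\mathcal C$ is Krull–Schmidt (every object is a finite direct sum of objects with local endomorphism rings). Fix an integer $n\ge 0$. Subcategories are full additive subcategories closed under isomorphisms. A conflation is a sequence $A\to B\to D$ realizing some $\delta\in\mathbb E(D,A)$; $D$ is then the cone of the inflation $A\to B$ and $A$ is the cocone of the deflation $B\to D$. For $i\ge 0$ put $\mathbb E^{i+1}(X,Y)=\mathbb E(\Omega^iX,Y)$, where $\Omega^iX$ is an $i$-th syzygy of $X$. For a subcategory $\mathcal X$ let $\mathcal X^{\perp}=\{Y:\mathbb E^i(X,Y)=0\ \ \forall i\ge1,\ X\in\mathcal X\}$ and ${}^{\perp}\mathcal X=\{Y:\mathbb E^i(Y,X)=0\ \ \forall i\ge1,\ X\in\mathcal X\}$. Let $\hat{\mathcal X}_n$ (resp. $\check{\mathcal X}_n$) consist of the objects $A$ that admit a sequence $X_n\to\cdots\to X_0\to A$ (resp. $A\to X_0\to\cdots\to X_n$) with all $X_i\in\mathcal X$ that is spliced from conflations: conflations $K_{i+1}\to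 X_i\to K_i$ (resp. $K_i\to X_i\to K_{i+1}$) for $0\le i<n$ with $K_0=A$ and $K_n=X_n$. The projective (injective) dimension of $A$ is the least $m$ such that $A$ lies in $\widehat{\mathrm{Proj}(\mathcal C)}_m$ (resp. $\check{\mathrm{Inj}(\mathcal C)}_m$), and $\infty$ if there is none. A subcategory $\mathcal T$ is a generator (resp. cogenerator) for $\mathcal Y$ if $\mathcal T\subseteq\mathcal Y$ and every $Y\in\mathcal Y$ admits a conflation $Y'\to T\to Y$ (resp. $Y\to T\to Y'$) with $T\in\mathcal T$, $Y'\in\mathcal Y$. A subcategory $\mathcal T$ closed under direct summands is tilting if all its objects have projective dimension at most $n$ and $\mathcal T$ is a generator for $\mathcal T^{\perp}$; it is cotilting if all its objects have injective dimension at most $n$ and $\mathcal T$ is a cogenerator for ${}^{\perp}\mathcal T$. A subcategory is coresolving (resp. resolving) if it contains all injectives (resp. projectives), is closed under extensions, and is closed under cones of inflations (resp. cocones of deflations) between its objects. It is covariantly (resp. contravariantly) finite if every object of $\mathcal C$ has a left (resp. right) approximation by it. Then: (i) The assignments $\mathcal T\mapsto\mathcal T^{\perp}$ and $\mathcal X\mapsto{}^{\perp}\mathcal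 X\cap\mathcal X$ are mutually inverse bijections between the class of tilting subcategories and the class of coresolving covariantly finite subcategories $\mathcal X$ that are closed under direct summands and satisfy $\check{\mathcal X}_n=\mathcal C$. (ii) The assignments $\mathcal T\mapsto{}^{\perp}\mathcal T$ and $\mathcal X\mapsto\mathcal X^{\perp}\cap\mathcal X$ are mutually inverse bijections between the class of cotilting subcategories and the class of resolving contravariantly finite subcategories $\mathcal X$ that are closed under direct summands and satisfy $\hat{\mathcal X}_n=\mathcal C$. -/

import Mathlib

open CategoryTheory CategoryTheory.Limits Opposite

attribute [local instance] hasBinaryBiproducts_of_finite_biproducts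

universe w v u

section

variable {C : Type u} [Category.{v} C]

/-- A sequence `A ⟶ B ⟶ D` with prescribed end terms `A` and `D`. -/
structure TwoTermSeq (A D : C) where
  mid : C
  left : A ⟶ mid
  right : mid ⟶ D

/-- Two sequences `A ⟶ B ⟶ D` and `A ⟶ B' ⟶ D` are equivalent if there is an isomorphism
`B ≅ B'` which is compatible with the identities of `A` and `D`. -/
instance TwoTermSeq.setoid (A D : C) : Setoid (TwoTermSeq A D) where
  r S S' := ∃ b : S.mid ≅ S'.mid, S.left ≫ b.hom = S'.left ∧ b.hom ≫ S'.right = S.right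
  iseqv :=
    { refl := fun S => ⟨Iso.refl _, by simp, by simp⟩
      symm := by
        rintro S S' ⟨b, h₁, h₂⟩
        exact ⟨b.symm, by simp [← h₁], by simp [← h₂]⟩
      trans := by
        rintro S S' S'' ⟨b, h₁, h₂⟩ ⟨b', h₁', h₂'⟩
        exact ⟨b ≪≫ b', by simp [← h₁', ← h₁], by simp [← h₂, ← h₂']⟩ }

/-- The equivalence class `[A ⟶ B ⟶ D]`. -/
def TwoTermSeq.cls {A B D : C} (x : A ⟶ B) (y : B ⟶ D) : Quotient (TwoTermSeq.setoid A D) :=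
  Quotient.mk _ ⟨B, x, y⟩

end

section

variable {C : Type u} [Category.{v} C]

/-- The group `𝔼(D, A)`. -/
abbrev EExt (E : Cᵒᵖ ⥤ C ⥤ AddCommGrpCat.{w}) (D A : C) : Type w :=
  ((E.obj (op D)).obj A : AddCommGrpCat.{w})

/-- `a_* δ = 𝔼(D, a)(δ)`. -/
def EExt.push (E : Cᵒᵖ ⥤ C ⥤ AddCommGrpCat.{w}) {D A A' : C} (a : A ⟶ A') (δ : EExt E D A) :
    EExt E D A' :=
  ((E.obj (op D)).map a).hom δ

/-- `c^* δ = 𝔼(c, A)(δ)`. -/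
def EExt.pull (E : Cᵒᵖ ⥤ C ⥤ AddCommGrpCat.{w}) {D D' A : C} (c : D' ⟶ D) (δ : EExt E D A) :
    EExt E D' A :=
  ((E.map c.op).app A).hom δ

/-- The direct sum `δ ⊕ δ' ∈ 𝔼(D ⊞ D', A ⊞ A')`, the element that corresponds to
`(δ, 0, 0, δ')` under biadditivity. -/
noncomputable def EExt.sum [Preadditive C] [HasFiniteBiproducts C]
    (E : Cᵒᵖ ⥤ C ⥤ AddCommGrpCat.{w}) {D D' A A' : C}
    (δ : EExt E D A) (δ' : EExt E D' A') : EExt E (D ⊞ D') (A ⊞ A') :=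
  EExt.push E biprod.inl (EExt.pull E biprod.fst δ) + EExt.push E biprod.inr (EExt.pull E biprod.snd δ')

end

/-- An external triangulation `(𝔼, 𝔰)` of an additive category `C` (Nakaoka and Palu);
a category with such a structure is an extriangulated category. -/
structure Extriangulation (C : Type u) [Category.{v} C] [Preadditive C]
    [HasFiniteBiproducts C] where
  /-- The bifunctor `𝔼 : Cᵒᵖ × C ⟶ Ab`. -/
  E : Cᵒᵖ ⥤ C ⥤ AddCommGrpCat.{w}
  /-- (ET1): `𝔼` is additive in both variables. -/
  additive_right : ∀ D : Cᵒᵖ, (E.obj D).Additive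
  additive_left : ∀ A : C, (E.flip.obj A).Additive
  /-- `𝔰` sends `δ ∈ 𝔼(D, A)` to an equivalence class of sequences `A ⟶ B ⟶ D`. -/
  s : ∀ {D A : C}, EExt E D A → Quotient (TwoTermSeq.setoid A D)
  /-- (ET2): `𝔰` is a realization, -/
  realization : ∀ {A B D A' B' D' : C} (x : A ⟶ B) (y : B ⟶ D) (x' : A' ⟶ B') (y' : B' ⟶ D')
    (δ : EExt E D A) (δ' : EExt E D' A'),
    s δ = TwoTermSeq.cls x y → s δ' = TwoTermSeq.cls x' y' →
    ∀ (a : A ⟶ A') (c : D ⟶ D'), EExt.push E a δ = EExt.pull E c δ' →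
      ∃ b : B ⟶ B', x ≫ b = a ≫ x' ∧ y ≫ c = b ≫ y'
  /-- which is additive. -/
  s_zero : ∀ A D : C, s (0 : EExt E D A) =
    TwoTermSeq.cls (biprod.inl : A ⟶ A ⊞ D) (biprod.snd : A ⊞ D ⟶ D)
  s_sum : ∀ {A B D A' B' D' : C} (x : A ⟶ B) (y : B ⟶ D) (x' : A' ⟶ B') (y' : B' ⟶ D')
    (δ : EExt E D A) (δ' : EExt E D' A'),
    s δ = TwoTermSeq.cls x y → s δ' = TwoTermSeq.cls x' y' →
    s (EExt.sum E δ δ') = TwoTermSeq.cls (biprod.map x x') (biprod.map y y')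
  /-- (ET3) -/
  et3 : ∀ {A B D A' B' D' : C} (x : A ⟶ B) (y : B ⟶ D) (x' : A' ⟶ B') (y' : B' ⟶ D')
    (δ : EExt E D A) (δ' : EExt E D' A'),
    s δ = TwoTermSeq.cls x y → s δ' = TwoTermSeq.cls x' y' →
    ∀ (a : A ⟶ A') (b : B ⟶ B'), x ≫ b = a ≫ x' →
      ∃ c : D ⟶ D', EExt.push E a δ = EExt.pull E c δ' ∧ y ≫ c = b ≫ y'
  /-- (ET3)ᵒᵖ -/
  et3_op : ∀ {A B D A' B' D' : C} (x : A ⟶ B) (y : B ⟶ D) (x' : A' ⟶ B') (y' : B' ⟶ D')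
    (δ : EExt E D A) (δ' : EExt E D' A'),
    s δ = TwoTermSeq.cls x y → s δ' = TwoTermSeq.cls x' y' →
    ∀ (b : B ⟶ B') (c : D ⟶ D'), y ≫ c = b ≫ y' →
      ∃ a : A ⟶ A', EExt.push E a δ = EExt.pull E c δ' ∧ x ≫ b = a ≫ x'
  /-- (ET4) -/
  et4 : ∀ {A B D G F : C} (f : A ⟶ B) (f' : B ⟶ D) (g : B ⟶ G) (g' : G ⟶ F)
    (δ : EExt E D A) (δ' : EExt E F B),
    s δ = TwoTermSeq.cls f f' → s δ' = TwoTermSeq.cls g g' →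
    ∃ (H : C) (h : A ⟶ G) (h' : G ⟶ H) (d : D ⟶ H) (e : H ⟶ F) (δ'' : EExt E H A),
      h = f ≫ g ∧ f' ≫ d = g ≫ h' ∧ h' ≫ e = g' ∧
      s δ'' = TwoTermSeq.cls h h' ∧
      s (EExt.push E f' δ') = TwoTermSeq.cls d e ∧
      EExt.pull E d δ'' = δ ∧
      EExt.push E f δ'' = EExt.pull E e δ'
  /-- (ET4)ᵒᵖ -/
  et4_op : ∀ {D A B F G : C} (f' : D ⟶ A) (f : A ⟶ B) (g' : F ⟶ B) (g : B ⟶ G)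
    (δ : EExt E B D) (δ' : EExt E G F),
    s δ = TwoTermSeq.cls f' f → s δ' = TwoTermSeq.cls g' g →
    ∃ (H : C) (d : D ⟶ H) (e : H ⟶ F) (h' : H ⟶ A) (h : A ⟶ G) (δ'' : EExt E G H),
      d ≫ h' = f' ∧ h' ≫ f = e ≫ g' ∧ h = f ≫ g ∧
      s δ'' = TwoTermSeq.cls h' h ∧
      s (EExt.pull E g' δ) = TwoTermSeq.cls d e ∧
      δ' = EExt.push E e δ'' ∧
      EExt.push E d δ = EExt.pull E g δ''

/-- A Krull-Schmidt category: every object is a finite direct sum of objects with local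
endomorphism rings. -/
def IsKrullSchmidt (C : Type u) [Category.{v} C] [Preadditive C] [HasFiniteBiproducts C] : Prop :=
  ∀ X : C, ∃ (m : ℕ) (F : Fin m → C), (∀ i, IsLocalRing (End (F i))) ∧ Nonempty (X ≅ ⨁ F)

section

variable {C : Type u} [Category.{v} C] [Preadditive C] [HasFiniteBiproducts C]

/-- The objects of a full additive subcategory closed under isomorphisms. -/
structure IsAdditiveSubcategory (P : ObjectProperty C) : Prop where
  iso_closed : ∀ {X Y : C}, (X ≅ Y) → P X → P Y
  zero_mem : ∀ {Z : C}, IsZero Z → P Z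
  sum_mem : ∀ {X Y : C}, P X → P Y → P (X ⊞ Y)

/-- Closure under direct summands. -/
def ClosedUnderSummands (P : ObjectProperty C) : Prop :=
  ∀ {X Y Z : C}, (Z ≅ X ⊞ Y) → P Z → P X

/-- Every object `A` has a left `P`-approximation `A ⟶ Y`. -/
def IsCovariantlyFinite (P : ObjectProperty C) : Prop :=
  ∀ A : C, ∃ (Y : C) (g : A ⟶ Y), P Y ∧ ∀ (X : C), P X → ∀ f : A ⟶ X, ∃ k : Y ⟶ X, g ≫ k = f

/-- Every object `A` has a right `P`-approximation `Y ⟶ A`. -/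
def IsContravariantlyFinite (P : ObjectProperty C) : Prop :=
  ∀ A : C, ∃ (Y : C) (g : Y ⟶ A), P Y ∧ ∀ (X : C), P X → ∀ f : X ⟶ A, ∃ k : X ⟶ Y, k ≫ g = f

namespace Extriangulation

variable (𝓔 : Extriangulation.{w} C)

/-- `A ⟶ B ⟶ D` is a conflation: it realizes some `δ ∈ 𝔼(D, A)`. -/
def Conflation {A B D : C} (x : A ⟶ B) (y : B ⟶ D) : Prop :=
  ∃ δ : EExt 𝓔.E D A, 𝓔.s δ = TwoTermSeq.cls x y

/-- The projective objects, `Proj(C)`. -/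
def proj : ObjectProperty C := fun P =>
  ∀ {A B D : C} (x : A ⟶ B) (y : B ⟶ D), 𝓔.Conflation x y →
    ∀ c : P ⟶ D, ∃ b : P ⟶ B, b ≫ y = c

/-- The injective objects, `Inj(C)`. -/
def inj : ObjectProperty C := fun I =>
  ∀ {A B D : C} (x : A ⟶ B) (y : B ⟶ D), 𝓔.Conflation x y →
    ∀ c : A ⟶ I, ∃ b : B ⟶ I, x ≫ b = c

def EnoughProj : Prop :=
  ∀ D : C, ∃ (A P : C) (x : A ⟶ P) (y : P ⟶ D), 𝓔.Conflation x y ∧ 𝓔.proj P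

def EnoughInj : Prop :=
  ∀ A : C, ∃ (I D : C) (x : A ⟶ I) (y : I ⟶ D), 𝓔.Conflation x y ∧ 𝓔.inj I

variable {𝓔} in
/-- A chosen syzygy `Ω X`, the first term of a conflation `Ω X ⟶ P ⟶ X` with `P` projective. -/
noncomputable def syzygy (hP : 𝓔.EnoughProj) (X : C) : C := (hP X).choose

variable {𝓔} in
/-- The iterated syzygy `Ωⁱ X`. -/
noncomputable def iterSyzygy (hP : 𝓔.EnoughProj) : ℕ → C → C
  | 0, X => X
  | i + 1, X => syzygy hP (iterSyzygy hP i X)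

variable {𝓔} in
/-- The higher extension group `𝔼ⁱ⁺¹(X, Y) = 𝔼(Ωⁱ X, Y)` (note the index: `i = 0` gives `𝔼`). -/
noncomputable abbrev higherExt (hP : 𝓔.EnoughProj) (i : ℕ) (X Y : C) : Type w :=
  EExt 𝓔.E (iterSyzygy hP i X) Y

variable {𝓔} in
/-- `P^⊥`, the objects `Y` with `𝔼ⁱ(X, Y) = 0` for all `i ≥ 1` and all `X` in `P`. -/
def rightPerp (hP : 𝓔.EnoughProj) (P : ObjectProperty C) : ObjectProperty C := fun Y =>
  ∀ X, P X → ∀ (i : ℕ) (e : higherExt hP i X Y), e = 0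

variable {𝓔} in
/-- `^⊥P`, the objects `Y` with `𝔼ⁱ(Y, X) = 0` for all `i ≥ 1` and all `X` in `P`. -/
def leftPerp (hP : 𝓔.EnoughProj) (P : ObjectProperty C) : ObjectProperty C := fun Y =>
  ∀ X, P X → ∀ (i : ℕ) (e : higherExt hP i Y X), e = 0

/-- The objects `A` with an `𝔼`-triangle sequence `Tₙ ⟶ ⋯ ⟶ T₁ ⟶ T₀ ⟶ A`, all `Tᵢ` in `P`.
Such a sequence is spliced from conflations `Kᵢ₊₁ ⟶ Tᵢ ⟶ Kᵢ` for `0 ≤ i < n`, with `K₀ = A` and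
`Kₙ = Tₙ`. -/
def hat (P : ObjectProperty C) : ℕ → ObjectProperty C
  | 0 => P
  | n + 1 => fun A => ∃ (K T₀ : C) (x : K ⟶ T₀) (y : T₀ ⟶ A),
      𝓔.Conflation x y ∧ P T₀ ∧ hat P n K

/-- The objects `A` with an `𝔼`-triangle sequence `A ⟶ T₀ ⟶ T₁ ⟶ ⋯ ⟶ Tₙ`, all `Tᵢ` in `P`. -/
def check (P : ObjectProperty C) : ℕ → ObjectProperty C
  | 0 => P
  | n + 1 => fun A => ∃ (T₀ K : C) (x : A ⟶ T₀) (y : T₀ ⟶ K),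
      𝓔.Conflation x y ∧ P T₀ ∧ check P n K

/-- The projective dimension: the least length of a projective resolution, `⊤` if there is no
finite one. -/
noncomputable def projDim (A : C) : ℕ∞ := ⨅ (m : ℕ) (_ : 𝓔.hat 𝓔.proj m A), (m : ℕ∞)

/-- The injective dimension. -/
noncomputable def injDim (A : C) : ℕ∞ := ⨅ (m : ℕ) (_ : 𝓔.check 𝓔.inj m A), (m : ℕ∞)

/-- `P` is a generator for `Q`. -/
def IsGeneratorFor (P Q : ObjectProperty C) : Prop :=
  P ≤ Q ∧ ∀ Y, Q Y → ∃ (Y' X : C) (x : Y' ⟶ X) (y : X ⟶ Y), 𝓔.Conflation x y ∧ P X ∧ Q Y'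

/-- `P` is a cogenerator for `Q`. -/
def IsCogeneratorFor (P Q : ObjectProperty C) : Prop :=
  P ≤ Q ∧ ∀ Y, Q Y → ∃ (X Y' : C) (x : Y ⟶ X) (y : X ⟶ Y'), 𝓔.Conflation x y ∧ P X ∧ Q Y'

variable {𝓔} in
/-- Tilting subcategories of projective dimension (at most) `n`. -/
structure IsTilting (hP : 𝓔.EnoughProj) (n : ℕ) (P : ObjectProperty C) : Prop where
  additive : IsAdditiveSubcategory P
  summands : ClosedUnderSummands P
  projDim_le : ∀ X, P X → 𝓔.projDim X ≤ n
  generator : 𝓔.IsGeneratorFor P (rightPerp hP P)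

variable {𝓔} in
/-- Cotilting subcategories of injective dimension (at most) `n`. -/
structure IsCotilting (hP : 𝓔.EnoughProj) (n : ℕ) (P : ObjectProperty C) : Prop where
  additive : IsAdditiveSubcategory P
  summands : ClosedUnderSummands P
  injDim_le : ∀ X, P X → 𝓔.injDim X ≤ n
  cogenerator : 𝓔.IsCogeneratorFor P (leftPerp hP P)

/-- `P` is coresolving: it contains the injectives and is closed under extensions and under
cones of inflations between its objects. -/
structure IsCoresolving (P : ObjectProperty C) : Prop where
  additive : IsAdditiveSubcategory P
  inj_le : 𝓔.inj ≤ P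
  ext_closed : ∀ {A B D : C} (x : A ⟶ B) (y : B ⟶ D), 𝓔.Conflation x y → P A → P D → P B
  cone_closed : ∀ {A B D : C} (x : A ⟶ B) (y : B ⟶ D), 𝓔.Conflation x y → P A → P B → P D

/-- `P` is resolving: it contains the projectives and is closed under extensions and under
cocones of deflations between its objects. -/
structure IsResolving (P : ObjectProperty C) : Prop where
  additive : IsAdditiveSubcategory P
  proj_le : 𝓔.proj ≤ P
  ext_closed : ∀ {A B D : C} (x : A ⟶ B) (y : B ⟶ D), 𝓔.Conflation x y → P A → P D → P B
  cocone_closed : ∀ {A B D : C} (x : A ⟶ B) (y : B ⟶ D), 𝓔.Conflation x y → P B → P D → P A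

end Extriangulation

end

/-!
# Tilting subcategories and coresolving subcategories of an extriangulated category

A conflation `A ⟶ B ⟶ D` gives the usual exact sequences for `Hom` and `𝔼`, and `𝔼(ΩX, Y)` and
`𝔼(X, ΣY)` vanish together (`forall_eq_zero_iff_of_proj_of_inj`). So the vanishing of
`𝔼ⁱ⁺¹(X, Y)` can be shifted in either variable, is independent of the chosen syzygies, and
propagates along conflations; only vanishing statements are needed, never the higher groups
themselves.

If `T` is tilting, then `X = T^⊥` is coresolving, and the `n`-th cosyzygy of any object lies in `X`
because objects of `T` have projective dimension at most `n`. As `T` is a generator for `X` which is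
left orthogonal to `X`, an Auslander-Buchweitz construction (`exists_approx_of_check`) turns an
`X`-coresolution of `A` into a conflation `A ⟶ X' ⟶ Z` with `X'` in `X` and `Z` in `^⊥X`, whose
inflation is a left approximation. An object `Y` of `^⊥X ∩ X` has a conflation `Y' ⟶ T' ⟶ Y` with
`T'` in `T` and `Y'` in `X`; it splits, so `Y` is a direct summand of `T'`.

Conversely, let `X` be coresolving, covariantly finite and closed under summands, and let every
object have an `X`-coresolution of length `n`. In a Krull-Schmidt category the
summands that a left `X`-approximation misses can be split off one at a time, together with the cone
of the approximation, which leaves a minimal one (`IsCoresolving.exists_leftMinimal`); its cone lies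
in `^⊥X` by Wakamatsu's lemma. So every `A` has a conflation `A ⟶ X' ⟶ Z` with `X'` in `X` and `Z`
in `^⊥X`. If `W` is in `^⊥X` then so is `X'` in such a conflation `W ⟶ X' ⟶ Z`, so that `X'` lies in
`T = ^⊥X ∩ X`. The `X`-coresolutions bound the projective dimension of objects of `^⊥X` by `n`, so
descending induction on the degree shows that they are left orthogonal to `T^⊥`. Hence for `Y` in `T^⊥` the
conflation `Y ⟶ X' ⟶ Z` splits and `Y` lies in `X`. Finally a pushout of `ΩY ⟶ P` and
`ΩY ⟶ X'` shows that `T` is a generator for `X`.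

The cotilting half is the tilting half for the opposite extriangulation on `Cᵒᵖ`
(`Extriangulation.opposite`).
-/

section

/-! ### Push-forward and pull-back of extensions -/

section

variable {C : Type u} [Category.{v} C]

theorem TwoTermSeq.cls_eq_iff {A B B' D : C} {x : A ⟶ B} {y : B ⟶ D} {x' : A ⟶ B'}
    {y' : B' ⟶ D} :
    TwoTermSeq.cls x y = TwoTermSeq.cls x' y' ↔ ∃ b : B ≅ B', x ≫ b.hom = x' ∧ b.hom ≫ y' = y :=
  ⟨fun h => Quotient.exact h, fun h => Quotient.sound h⟩

theorem TwoTermSeq.exists_rep {A D : C} (q : Quotient (TwoTermSeq.setoid A D)) :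
    ∃ (B : C) (x : A ⟶ B) (y : B ⟶ D), q = TwoTermSeq.cls x y := by
  obtain ⟨⟨B, x, y⟩, rfl⟩ := Quotient.exists_rep q
  exact ⟨B, x, y, rfl⟩

namespace EExt

variable (E : Cᵒᵖ ⥤ C ⥤ AddCommGrpCat.{w})

@[simp] theorem push_add {D A A' : C} (a : A ⟶ A') (δ ε : EExt E D A) :
    push E a (δ + ε) = push E a δ + push E a ε := map_add _ _ _

@[simp] theorem push_zero {D A A' : C} (a : A ⟶ A') :
    push E a (0 : EExt E D A) = 0 := map_zero _

@[simp] theorem push_sub {D A A' : C} (a : A ⟶ A') (δ ε : EExt E D A) :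
    push E a (δ - ε) = push E a δ - push E a ε := map_sub _ _ _

@[simp] theorem pull_add {D D' A : C} (c : D' ⟶ D) (δ ε : EExt E D A) :
    pull E c (δ + ε) = pull E c δ + pull E c ε := map_add _ _ _

@[simp] theorem pull_zero {D D' A : C} (c : D' ⟶ D) :
    pull E c (0 : EExt E D A) = 0 := map_zero _

@[simp] theorem pull_sub {D D' A : C} (c : D' ⟶ D) (δ ε : EExt E D A) :
    pull E c (δ - ε) = pull E c δ - pull E c ε := map_sub _ _ _

@[simp] theorem push_id {D A : C} (δ : EExt E D A) : push E (𝟙 A) δ = δ := by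
  simp [push]

@[simp] theorem pull_id {D A : C} (δ : EExt E D A) : pull E (𝟙 D) δ = δ := by
  simp [pull]

theorem push_comp {D A A' A'' : C} (a : A ⟶ A') (a' : A' ⟶ A'') (δ : EExt E D A) :
    push E (a ≫ a') δ = push E a' (push E a δ) := by
  simp [push]

theorem pull_comp {D D' D'' A : C} (c : D' ⟶ D) (c' : D'' ⟶ D') (δ : EExt E D A) :
    pull E (c' ≫ c) δ = pull E c' (pull E c δ) := by
  simp [pull]

theorem push_pull {D D' A A' : C} (a : A ⟶ A') (c : D' ⟶ D) (δ : EExt E D A) :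
    push E a (pull E c δ) = pull E c (push E a δ) := by
  simp [push, pull]

end EExt

end

variable {C : Type u} [Category.{v} C] [Preadditive C] [HasFiniteBiproducts C]

namespace Extriangulation

variable (𝓔 : Extriangulation.{w} C)

theorem add_push {D A A' : C} (a a' : A ⟶ A') (δ : EExt 𝓔.E D A) :
    EExt.push 𝓔.E (a + a') δ = EExt.push 𝓔.E a δ + EExt.push 𝓔.E a' δ := by
  have := 𝓔.additive_right (op D)
  simp [EExt.push, Functor.map_add]

theorem add_pull {D D' A : C} (c c' : D' ⟶ D) (δ : EExt 𝓔.E D A) :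
    EExt.pull 𝓔.E (c + c') δ = EExt.pull 𝓔.E c δ + EExt.pull 𝓔.E c' δ := by
  have := 𝓔.additive_left A
  have h := (𝓔.E.flip.obj A).map_add (f := c.op) (g := c'.op)
  have h' := congrArg (fun f => f.hom δ) h
  simpa [EExt.pull] using h'

@[simp] theorem zero_push {D A A' : C} (δ : EExt 𝓔.E D A) :
    EExt.push 𝓔.E (0 : A ⟶ A') δ = 0 := by
  have := 𝓔.add_push (0 : A ⟶ A') 0 δ
  simpa using this

@[simp] theorem zero_pull {D D' A : C} (δ : EExt 𝓔.E D A) :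
    EExt.pull 𝓔.E (0 : D' ⟶ D) δ = 0 := by
  have := 𝓔.add_pull (0 : D' ⟶ D) 0 δ
  simpa using this

theorem eq_zero_of_isZero_left {D A : C} (hD : IsZero D) (δ : EExt 𝓔.E D A) : δ = 0 := by
  rw [← EExt.pull_id 𝓔.E δ, hD.eq_of_src (𝟙 D) 0, zero_pull]

theorem eq_zero_of_isZero_right {D A : C} (hA : IsZero A) (δ : EExt 𝓔.E D A) : δ = 0 := by
  rw [← EExt.push_id 𝓔.E δ, hA.eq_of_src (𝟙 A) 0, zero_push]

variable {𝓔}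

/-! ### Exact sequences attached to a conflation -/

section exact

open scoped ZeroObject

theorem conflation_zero (A D : C) :
    𝓔.Conflation (biprod.inl : A ⟶ A ⊞ D) (biprod.snd : A ⊞ D ⟶ D) := ⟨0, 𝓔.s_zero A D⟩

/-- A direct sum diagram is a conflation realizing `0`. -/
theorem s_zero_of_split {A B D : C} {x : A ⟶ B} {y : B ⟶ D} {r : B ⟶ A} {t : D ⟶ B}
    (hxr : x ≫ r = 𝟙 A) (hty : t ≫ y = 𝟙 D) (hxy : x ≫ y = 0) (htr : t ≫ r = 0)
    (h : r ≫ x + y ≫ t = 𝟙 B) : 𝓔.s (0 : EExt 𝓔.E D A) = TwoTermSeq.cls x y := by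
  rw [𝓔.s_zero, TwoTermSeq.cls_eq_iff]
  refine ⟨⟨biprod.desc x t, biprod.lift r y, ?_, ?_⟩, ?_, ?_⟩
  · ext <;> simp [hxr, hty, hxy, htr]
  · simp [h]
  · simp
  · ext <;> simp [hxy, hty]

variable {A B D : C} {x : A ⟶ B} {y : B ⟶ D} {δ : EExt 𝓔.E D A}

theorem comp_eq_zero (h : 𝓔.s δ = TwoTermSeq.cls x y) : x ≫ y = 0 := by
  -- The identity of `A` and `x` form a morphism from the conflation `A ⟶ A ⊞ 0 ⟶ 0`.
  obtain ⟨c, -, hc⟩ := 𝓔.et3 _ _ _ _ _ _ (𝓔.s_zero A (0 : C)) h (𝟙 A) (biprod.desc x 0) (by simp)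
  have := (biprod.inl : A ⟶ A ⊞ (0 : C)) ≫= hc
  simpa using this.symm

theorem push_left_eq_zero (h : 𝓔.s δ = TwoTermSeq.cls x y) : EExt.push 𝓔.E x δ = 0 := by
  obtain ⟨c, hc, -⟩ := 𝓔.et3 _ _ _ _ _ _ h (𝓔.s_zero B (0 : C)) x biprod.inl rfl
  simpa using hc

theorem pull_right_eq_zero (h : 𝓔.s δ = TwoTermSeq.cls x y) : EExt.pull 𝓔.E y δ = 0 := by
  obtain ⟨c, hc, -⟩ := 𝓔.et3_op _ _ _ _ _ _ (𝓔.s_zero (0 : C) B) h biprod.snd y rfl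
  simpa using hc.symm

theorem exists_desc (h : 𝓔.s δ = TwoTermSeq.cls x y) {W : C} (f : B ⟶ W) (hf : x ≫ f = 0) :
    ∃ c : D ⟶ W, y ≫ c = f := by
  obtain ⟨c, -, hc⟩ := 𝓔.et3 _ _ _ _ _ _ h (𝓔.s_zero (0 : C) W) 0 (biprod.lift 0 f)
    (by ext; all_goals simp [hf])
  exact ⟨c, by simpa using hc⟩

theorem exists_lift (h : 𝓔.s δ = TwoTermSeq.cls x y) {W : C} (f : W ⟶ B) (hf : f ≫ y = 0) :
    ∃ c : W ⟶ A, c ≫ x = f := by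
  obtain ⟨c, -, hc⟩ := 𝓔.et3_op _ _ _ _ _ _ (𝓔.s_zero W (0 : C)) h (biprod.desc f 0) 0
    (by ext; all_goals simp [hf])
  exact ⟨c, by simpa using hc.symm⟩

/-- A morphism `f` with `f_* δ = 0` extends along the inflation. -/
theorem exists_extension (h : 𝓔.s δ = TwoTermSeq.cls x y) {W : C} (f : A ⟶ W)
    (hf : EExt.push 𝓔.E f δ = 0) : ∃ g : B ⟶ W, x ≫ g = f := by
  obtain ⟨b, hb, -⟩ := 𝓔.realization _ _ _ _ _ _ h (𝓔.s_zero W D) f (𝟙 D) (by simp [hf])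
  exact ⟨b ≫ biprod.fst, by simp [reassoc_of% hb]⟩

/-- A morphism `f` with `f^* δ = 0` lifts along the deflation. -/
theorem exists_lifting (h : 𝓔.s δ = TwoTermSeq.cls x y) {W : C} (f : W ⟶ D)
    (hf : EExt.pull 𝓔.E f δ = 0) : ∃ g : W ⟶ B, g ≫ y = f := by
  obtain ⟨b, -, hb⟩ := 𝓔.realization _ _ _ _ _ _ (𝓔.s_zero A W) h (𝟙 A) f (by simp [hf])
  exact ⟨biprod.inr ≫ b, by simp [← hb]⟩

/-- Exactness of `C(A, W) ⟶ 𝔼(D, W) ⟶ 𝔼(B, W)`. -/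
theorem exists_push_eq (h : 𝓔.s δ = TwoTermSeq.cls x y) {W : C} (ε : EExt 𝓔.E D W)
    (hε : EExt.pull 𝓔.E y ε = 0) : ∃ f : A ⟶ W, EExt.push 𝓔.E f δ = ε := by
  obtain ⟨U, i, p, hU⟩ := TwoTermSeq.exists_rep (𝓔.s ε)
  obtain ⟨b, hb⟩ := exists_lifting hU y hε
  obtain ⟨a, ha, -⟩ := 𝓔.et3_op _ _ _ _ _ _ h hU b (𝟙 D) (by simp [hb])
  exact ⟨a, by simpa using ha⟩

/-- Exactness of `C(W, D) ⟶ 𝔼(W, A) ⟶ 𝔼(W, B)`. -/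
theorem exists_pull_eq (h : 𝓔.s δ = TwoTermSeq.cls x y) {W : C} (ε : EExt 𝓔.E W A)
    (hε : EExt.push 𝓔.E x ε = 0) : ∃ f : W ⟶ D, EExt.pull 𝓔.E f δ = ε := by
  obtain ⟨U, i, p, hU⟩ := TwoTermSeq.exists_rep (𝓔.s ε)
  obtain ⟨b, hb⟩ := exists_extension hU x hε
  obtain ⟨c, hc, -⟩ := 𝓔.et3 _ _ _ _ _ _ hU h (𝟙 A) b (by simp [hb])
  exact ⟨c, by simpa using hc.symm⟩

/-- Exactness of `𝔼(W, A) ⟶ 𝔼(W, B) ⟶ 𝔼(W, D)`. -/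
theorem exists_push_left_eq (h : 𝓔.s δ = TwoTermSeq.cls x y) {W : C} (ε : EExt 𝓔.E W B)
    (hε : EExt.push 𝓔.E y ε = 0) : ∃ ε' : EExt 𝓔.E W A, EExt.push 𝓔.E x ε' = ε := by
  obtain ⟨U, i, p, hU⟩ := TwoTermSeq.exists_rep (𝓔.s ε)
  obtain ⟨H, h', k, d, e, δ'', -, -, -, -, hd, -, hδ⟩ := 𝓔.et4 _ _ _ _ _ _ h hU
  obtain ⟨t, ht⟩ := exists_lifting hd (𝟙 W) (by simp [hε])
  exact ⟨EExt.pull 𝓔.E t δ'', by rw [EExt.push_pull, hδ, ← EExt.pull_comp, ht, EExt.pull_id]⟩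

/-- Exactness of `𝔼(D, W) ⟶ 𝔼(B, W) ⟶ 𝔼(A, W)`. -/
theorem exists_pull_right_eq (h : 𝓔.s δ = TwoTermSeq.cls x y) {W : C} (ε : EExt 𝓔.E B W)
    (hε : EExt.pull 𝓔.E x ε = 0) : ∃ ε' : EExt 𝓔.E D W, EExt.pull 𝓔.E y ε' = ε := by
  obtain ⟨U, i, p, hU⟩ := TwoTermSeq.exists_rep (𝓔.s ε)
  obtain ⟨H, d, e, h', k, δ'', -, -, -, -, hd, -, hδ⟩ := 𝓔.et4_op _ _ _ _ _ _ hU h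
  obtain ⟨t, ht⟩ := exists_extension hd (𝟙 W) (by simp [hε])
  exact ⟨EExt.push 𝓔.E t δ'', by rw [← EExt.push_pull, ← hδ, ← EExt.push_comp, ht, EExt.push_id]⟩

theorem eq_zero_of_section (h : 𝓔.s δ = TwoTermSeq.cls x y) (t : D ⟶ B) (ht : t ≫ y = 𝟙 D) :
    δ = 0 := by
  rw [← EExt.pull_id 𝓔.E δ, ← ht, EExt.pull_comp, pull_right_eq_zero h, EExt.pull_zero]

/-- A sequence that realizes `0` is a direct sum diagram. -/
theorem exists_split (h : 𝓔.s δ = TwoTermSeq.cls x y) (hδ : δ = 0) :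
    ∃ b : B ≅ A ⊞ D, x ≫ b.hom = biprod.inl ∧ b.hom ≫ biprod.snd = y := by
  subst hδ
  rw [𝓔.s_zero, eq_comm] at h
  exact TwoTermSeq.cls_eq_iff.1 h

/-! ### Transport of realizations along isomorphisms -/

/-- A morphism of realizations which is invertible at the ends is invertible in the middle. -/
theorem isIso_middle (h : 𝓔.s δ = TwoTermSeq.cls x y) {A' B' D' : C} {x' : A' ⟶ B'}
    {y' : B' ⟶ D'} {δ' : EExt 𝓔.E D' A'} (h' : 𝓔.s δ' = TwoTermSeq.cls x' y')
    (a : A ≅ A') (b : B ⟶ B') (c : D ≅ D') (hab : x ≫ b = a.hom ≫ x') (hbc : y ≫ c.hom = b ≫ y')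
    (hδ : EExt.push 𝓔.E a.hom δ = EExt.pull 𝓔.E c.hom δ') : IsIso b := by
  have hδ₁ : δ = EExt.pull 𝓔.E c.hom (EExt.push 𝓔.E a.inv δ') := by
    rw [← EExt.push_pull, ← hδ, ← EExt.push_comp, a.hom_inv_id, EExt.push_id]
  have hδ₂ : δ' = EExt.push 𝓔.E a.hom (EExt.pull 𝓔.E c.inv δ) := by
    rw [EExt.push_pull, hδ, ← EExt.pull_comp, c.inv_hom_id, EExt.pull_id]
  -- A right inverse of `b` is a lift `k` of `y'` corrected by a morphism through `A`, a left inverse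
  -- is an extension `k'` of `x` corrected by a morphism through `D`.
  obtain ⟨k, hk⟩ := exists_lifting h (y' ≫ c.inv) (by
    rw [hδ₁, ← EExt.pull_comp, Category.assoc, c.inv_hom_id, Category.comp_id, ← EExt.push_pull,
      pull_right_eq_zero h', EExt.push_zero])
  obtain ⟨l, hl⟩ := exists_lift h' (𝟙 B' - k ≫ b) (by
    rw [Preadditive.sub_comp, Category.assoc, ← hbc, reassoc_of% hk]; simp)
  obtain ⟨k', hk'⟩ := exists_extension h' (a.inv ≫ x) (by
    rw [hδ₂, ← EExt.push_comp, a.hom_inv_id_assoc, EExt.push_pull, push_left_eq_zero h,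
      EExt.pull_zero])
  obtain ⟨l', hl'⟩ := exists_desc h (𝟙 B - b ≫ k') (by
    rw [Preadditive.comp_sub, reassoc_of% hab, hk']; simp)
  have h₁ : (k + l ≫ a.inv ≫ x) ≫ b = 𝟙 B' := by
    rw [Preadditive.add_comp, Category.assoc, Category.assoc, hab, a.inv_hom_id_assoc, hl]
    abel
  have h₂ : b ≫ (k' + y' ≫ c.inv ≫ l') = 𝟙 B := by
    rw [Preadditive.comp_add, ← reassoc_of% hbc, c.hom_inv_id_assoc, hl']
    abel
  have : IsSplitEpi b := ⟨⟨⟨_, h₁⟩⟩⟩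
  have : IsSplitMono b := ⟨⟨⟨_, h₂⟩⟩⟩
  exact isIso_of_epi_of_isSplitMono b

/-- The realization of an extension transported along isomorphisms of its two end terms. -/
theorem s_transport (h : 𝓔.s δ = TwoTermSeq.cls x y) {A' D' : C} (a : A ≅ A') (c : D ≅ D') :
    𝓔.s (EExt.push 𝓔.E a.hom (EExt.pull 𝓔.E c.inv δ)) =
      TwoTermSeq.cls (a.inv ≫ x) (y ≫ c.hom) := by
  obtain ⟨U, i, p, hU⟩ :=
    TwoTermSeq.exists_rep (𝓔.s (EExt.push 𝓔.E a.hom (EExt.pull 𝓔.E c.inv δ)))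
  have hδ : EExt.push 𝓔.E a.hom δ =
      EExt.pull 𝓔.E c.hom (EExt.push 𝓔.E a.hom (EExt.pull 𝓔.E c.inv δ)) := by
    rw [← EExt.push_pull, ← EExt.pull_comp, c.hom_inv_id, EExt.pull_id]
  obtain ⟨b, hb, hb'⟩ := 𝓔.realization _ _ _ _ _ _ h hU a.hom c.hom hδ
  have := isIso_middle h hU a b c hb hb' hδ
  rw [hU, eq_comm, TwoTermSeq.cls_eq_iff]
  exact ⟨asIso b, by simp [hb], by simp [hb']⟩

theorem Conflation.transport (h : 𝓔.Conflation x y) {A' D' : C} (a : A ≅ A') (c : D ≅ D') :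
    𝓔.Conflation (a.inv ≫ x) (y ≫ c.hom) :=
  let ⟨_, h⟩ := h; ⟨_, s_transport h a c⟩

end exact

end Extriangulation

end

section

/-! ### The opposite extriangulation -/

section

variable {C : Type u} [Category.{v} C]

/-- The equivalence class of the opposite sequence. -/
def TwoTermSeq.opCls {A D : C} :
    Quotient (TwoTermSeq.setoid A D) → Quotient (TwoTermSeq.setoid (op D) (op A)) :=
  Quotient.map (fun S => ⟨op S.mid, S.right.op, S.left.op⟩) (by
    rintro S S' ⟨b, h₁, h₂⟩
    exact ⟨b.symm.op, by simp [← op_comp, ← h₂], by simp [← op_comp, ← h₁]⟩)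

theorem TwoTermSeq.opCls_injective {A D : C} :
    Function.Injective (TwoTermSeq.opCls : Quotient (TwoTermSeq.setoid A D) → _) := by
  intro q q' h
  obtain ⟨B, x, y, rfl⟩ := TwoTermSeq.exists_rep q
  obtain ⟨B', x', y', rfl⟩ := TwoTermSeq.exists_rep q'
  obtain ⟨b, h₁, h₂⟩ := TwoTermSeq.cls_eq_iff.1 h
  refine TwoTermSeq.cls_eq_iff.2 ⟨b.symm.unop, ?_, ?_⟩
  · exact Quiver.Hom.op_inj (by simp [← h₂])
  · exact Quiver.Hom.op_inj (by simp [← h₁])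

end

variable {C : Type u} [Category.{v} C] [Preadditive C] [HasFiniteBiproducts C]

instance hasFiniteBiproducts_op : HasFiniteBiproducts Cᵒᵖ :=
  HasFiniteBiproducts.of_hasFiniteProducts

namespace Extriangulation

variable (𝓔 : Extriangulation.{w} C)

/-- The bifunctor of the opposite extriangulation, `𝔼ᵒᵖ(D, A) = 𝔼(A, D)`. -/
abbrev opE : (Cᵒᵖ)ᵒᵖ ⥤ Cᵒᵖ ⥤ AddCommGrpCat.{w} := unopUnop C ⋙ 𝓔.E.flip

/-- The realization of the opposite extriangulation. -/
def opS {D A : Cᵒᵖ} (δ : EExt 𝓔.opE D A) : Quotient (TwoTermSeq.setoid A D) :=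
  TwoTermSeq.opCls (𝓔.s (D := A.unop) (A := D.unop) δ)

theorem opS_eq_iff {D B A : Cᵒᵖ} {δ : EExt 𝓔.opE D A} {x : A ⟶ B} {y : B ⟶ D} :
    𝓔.opS δ = TwoTermSeq.cls x y ↔
      𝓔.s (D := A.unop) (A := D.unop) δ = TwoTermSeq.cls y.unop x.unop :=
  ⟨fun h => TwoTermSeq.opCls_injective h, fun h => congrArg TwoTermSeq.opCls h⟩

/-- The opposite of a direct sum is a direct sum of the opposites. -/
noncomputable def biprodOp (A D : Cᵒᵖ) : A ⊞ D ≅ op (A.unop ⊞ D.unop) where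
  hom := biprod.desc (biprod.fst : A.unop ⊞ D.unop ⟶ _).op (biprod.snd : A.unop ⊞ D.unop ⟶ _).op
  inv := biprod.lift (biprod.inl : _ ⟶ A.unop ⊞ D.unop).op (biprod.inr : _ ⟶ A.unop ⊞ D.unop).op
  hom_inv_id := by
    ext <;> simp [← op_comp]
  inv_hom_id := by
    simp [biprod.lift_desc, ← op_comp, ← op_add]

/-- The direct sum of extensions for `𝔼ᵒᵖ` is the one for `𝔼`, up to the identification of the
opposite of a direct sum with a direct sum. -/
theorem sum_opE {D D' A A' : Cᵒᵖ} (δ : EExt 𝓔.opE D A) (δ' : EExt 𝓔.opE D' A') :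
    EExt.sum 𝓔.opE δ δ' = EExt.push 𝓔.E (biprodOp D D').unop.hom
      (EExt.pull 𝓔.E (biprodOp A A').unop.inv
        (EExt.sum 𝓔.E (D := A.unop) (A := D.unop) (D' := A'.unop) (A' := D'.unop) δ δ')) := by
  have push_eq {D A A' : Cᵒᵖ} (a : A ⟶ A') (δ : EExt 𝓔.opE D A) :
    EExt.push 𝓔.opE a δ = EExt.pull 𝓔.E (D := A.unop) (A := D.unop) a.unop δ := rfl
  have pull_eq {D D' A : Cᵒᵖ} (c : D' ⟶ D) (δ : EExt 𝓔.opE D A) :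
    EExt.pull 𝓔.opE c δ = EExt.push 𝓔.E (D := A.unop) (A := D.unop) c.unop δ := rfl
  simp only [EExt.sum, push_eq, pull_eq, EExt.push_add, EExt.pull_add]
  simp only [EExt.push_pull, ← EExt.push_comp, ← EExt.pull_comp]
  have inl_eq : (biprod.inl : A ⟶ A ⊞ A').unop =
      (biprodOp A A').unop.inv ≫ biprod.fst := Quiver.Hom.op_inj (by
      simp [biprodOp]; ext <;> simp [← op_comp])
  have inr_eq : (biprod.inr : A' ⟶ A ⊞ A').unop =
      (biprodOp A A').unop.inv ≫ biprod.snd := Quiver.Hom.op_inj (by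
      simp [biprodOp]; ext <;> simp [← op_comp])
  have fst_eq : (biprod.fst : D ⊞ D' ⟶ D).unop =
      biprod.inl ≫ (biprodOp D D').unop.hom := Quiver.Hom.op_inj (by
      simp [biprodOp]; ext <;> simp [← op_comp])
  have snd_eq : (biprod.snd : D ⊞ D' ⟶ D').unop =
      biprod.inr ≫ (biprodOp D D').unop.hom := Quiver.Hom.op_inj (by
      simp [biprodOp]; ext <;> simp [← op_comp])
  rw [inl_eq, inr_eq, fst_eq, snd_eq]

/-- The opposite extriangulation on `Cᵒᵖ`. -/
noncomputable def opposite : Extriangulation.{w} Cᵒᵖ where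
  E := 𝓔.opE
  additive_right D := ⟨fun {A A' a a'} => by
    ext δ
    exact 𝓔.add_pull a.unop a'.unop δ⟩
  additive_left A := ⟨fun {D D' c c'} => by
    ext δ
    exact 𝓔.add_push c.unop.unop c'.unop.unop δ⟩
  s := 𝓔.opS
  realization x y x' y' δ δ' h h' a c hac := by
    obtain ⟨b, hb, hb'⟩ := 𝓔.realization _ _ _ _ _ _ (𝓔.opS_eq_iff.1 h') (𝓔.opS_eq_iff.1 h)
      c.unop a.unop hac.symm
    exact ⟨b.op, Quiver.Hom.unop_inj hb'.symm, Quiver.Hom.unop_inj hb.symm⟩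
  s_zero A D := by
    rw [opS_eq_iff]
    exact s_zero_of_split (r := (biprod.inr : D ⟶ A ⊞ D).unop) (t := (biprod.fst : A ⊞ D ⟶ A).unop)
      (by simp [← unop_comp]) (by simp [← unop_comp]) (by simp [← unop_comp])
      (by simp [← unop_comp]) (by simp [← unop_comp, ← unop_add, add_comm])
  s_sum x y x' y' δ δ' h h' := by
    have hs := s_transport (𝓔.s_sum _ _ _ _ _ _ (𝓔.opS_eq_iff.1 h) (𝓔.opS_eq_iff.1 h'))
      (biprodOp _ _).unop (biprodOp _ _).unop
    have hE := 𝓔.sum_opE δ δ'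
    rw [opS_eq_iff]
    refine (congrArg 𝓔.s hE).trans (hs.trans
      (TwoTermSeq.cls_eq_iff.2 ⟨(biprodOp _ _).unop, ?_, ?_⟩))
    · apply Quiver.Hom.op_inj
      simp [biprodOp]
      ext <;> simp [← op_comp]
    · apply Quiver.Hom.op_inj
      simp [biprodOp]
      ext <;> simp [← op_comp]
      all_goals rfl
  et3 x y x' y' δ δ' h h' a b hab := by
    obtain ⟨c, hc, hc'⟩ := 𝓔.et3_op _ _ _ _ _ _ (𝓔.opS_eq_iff.1 h') (𝓔.opS_eq_iff.1 h)
      b.unop a.unop (Quiver.Hom.op_inj hab.symm)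
    exact ⟨c.op, hc.symm, Quiver.Hom.unop_inj hc'.symm⟩
  et3_op x y x' y' δ δ' h h' b c hbc := by
    obtain ⟨a, ha, ha'⟩ := 𝓔.et3 _ _ _ _ _ _ (𝓔.opS_eq_iff.1 h') (𝓔.opS_eq_iff.1 h)
      c.unop b.unop (Quiver.Hom.op_inj hbc.symm)
    exact ⟨a.op, ha.symm, Quiver.Hom.unop_inj ha'.symm⟩
  et4 f f' g g' δ δ' h h' := by
    obtain ⟨H, d, e, i, j, δ'', h₁, h₂, h₃, h₄, h₅, h₆, h₇⟩ :=
      𝓔.et4_op _ _ _ _ _ _ (𝓔.opS_eq_iff.1 h') (𝓔.opS_eq_iff.1 h)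
    exact ⟨op H, j.op, i.op, e.op, d.op, δ'', Quiver.Hom.unop_inj h₃,
      Quiver.Hom.unop_inj h₂.symm, Quiver.Hom.unop_inj h₁, 𝓔.opS_eq_iff.2 h₄,
      𝓔.opS_eq_iff.2 h₅, h₆.symm, h₇.symm⟩
  et4_op f' f g' g δ δ' h h' := by
    obtain ⟨H, i, j, d, e, δ'', h₁, h₂, h₃, h₄, h₅, h₆, h₇⟩ :=
      𝓔.et4 _ _ _ _ _ _ (𝓔.opS_eq_iff.1 h') (𝓔.opS_eq_iff.1 h)
    exact ⟨op H, e.op, d.op, j.op, i.op, δ'', Quiver.Hom.unop_inj h₃,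
      Quiver.Hom.unop_inj h₂.symm, Quiver.Hom.unop_inj h₁, 𝓔.opS_eq_iff.2 h₄,
      𝓔.opS_eq_iff.2 h₅, h₆.symm, h₇.symm⟩

variable {𝓔}

theorem opposite_conflation_iff {A B D : Cᵒᵖ} {x : A ⟶ B} {y : B ⟶ D} :
    𝓔.opposite.Conflation x y ↔ 𝓔.Conflation y.unop x.unop :=
  exists_congr fun _ => 𝓔.opS_eq_iff

theorem Conflation.op {A B D : C} {x : A ⟶ B} {y : B ⟶ D} (h : 𝓔.Conflation x y) :
    𝓔.opposite.Conflation y.op x.op :=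
  opposite_conflation_iff.2 h

theorem Conflation.unop {A B D : Cᵒᵖ} {x : A ⟶ B} {y : B ⟶ D}
    (h : 𝓔.opposite.Conflation x y) : 𝓔.Conflation y.unop x.unop :=
  opposite_conflation_iff.1 h

end Extriangulation

end

section

variable {C : Type u} [Category.{v} C] [Preadditive C] [HasFiniteBiproducts C]

namespace Extriangulation

variable {𝓔 : Extriangulation.{w} C}

/-! ### Composition and base change of conflations -/

/-- The composite of two deflations is a deflation, and its cocone is an extension of their
cocones. -/
theorem Conflation.comp_deflation {D A B F G : C} {f' : D ⟶ A} {f : A ⟶ B} {g' : F ⟶ B}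
    {g : B ⟶ G} (h : 𝓔.Conflation f' f) (h' : 𝓔.Conflation g' g) :
    ∃ (H : C) (d : D ⟶ H) (e : H ⟶ F) (k : H ⟶ A), 𝓔.Conflation d e ∧
      𝓔.Conflation k (f ≫ g) ∧ d ≫ k = f' := by
  obtain ⟨δ, h⟩ := h
  obtain ⟨δ', h'⟩ := h'
  obtain ⟨H, d, e, k, l, δ'', h₁, -, rfl, h₄, h₅, -, -⟩ := 𝓔.et4_op _ _ _ _ _ _ h h'
  exact ⟨H, d, e, k, ⟨_, h₅⟩, ⟨_, h₄⟩, h₁⟩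

/-- Base change of a deflation along another deflation: the object `M` plays the role of a pullback
of `y₁` and `y₂`. -/
theorem Conflation.exists_pullback {A₁ B₁ A₂ B₂ D : C} {x₁ : A₁ ⟶ B₁} {y₁ : B₁ ⟶ D}
    {x₂ : A₂ ⟶ B₂} {y₂ : B₂ ⟶ D} (h₁ : 𝓔.Conflation x₁ y₁) (h₂ : 𝓔.Conflation x₂ y₂) :
    ∃ (M : C) (i₁ : A₁ ⟶ M) (p₂ : M ⟶ B₂) (i₂ : A₂ ⟶ M) (p₁ : M ⟶ B₁),
      𝓔.Conflation i₁ p₂ ∧ 𝓔.Conflation i₂ p₁ := by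
  obtain ⟨δ₁, h₁⟩ := h₁
  obtain ⟨δ₂, h₂⟩ := h₂
  -- `M` realizes `y₁^* δ₂`. The cocone `H` of `M ⟶ B₁ ⟶ D` is an extension of `A₁` by `A₂` of
  -- class `x₁^* y₁^* δ₂ = 0`, hence a direct sum.
  obtain ⟨M, i₂, p₁, hM⟩ := TwoTermSeq.exists_rep (𝓔.s (EExt.pull 𝓔.E y₁ δ₂))
  obtain ⟨H, d, e, k, l, δ, -, -, -, hk, hde, hδ₁, hδ⟩ := 𝓔.et4_op _ _ _ _ _ _ hM h₁
  obtain ⟨b, hdb, hbe⟩ := exists_split hde (by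
    rw [← EExt.pull_comp, comp_eq_zero h₁, zero_pull])
  obtain ⟨r, hr⟩ := exists_push_eq h₁ (EExt.push 𝓔.E d δ₂ - δ) (by
    rw [EExt.pull_sub, ← EExt.push_pull, hδ, sub_self])
  obtain ⟨p₀, s₀, hdp, hsp, hse, hsum, hde0⟩ : ∃ (p₀ : H ⟶ A₂) (s₀ : A₁ ⟶ H), d ≫ p₀ = 𝟙 _ ∧
      s₀ ≫ p₀ = 0 ∧ s₀ ≫ e = 𝟙 _ ∧ p₀ ≫ d + e ≫ s₀ = 𝟙 _ ∧ d ≫ e = 0 := by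
    refine ⟨b.hom ≫ biprod.fst, biprod.inr ≫ b.inv, ?_, ?_, ?_, ?_, comp_eq_zero hde⟩
    · simp [reassoc_of% hdb]
    · simp
    · simp [← hbe]
    · have : d = biprod.inl ≫ b.inv := by simp [← hdb]
      simp only [this, ← hbe, Category.assoc, ← Preadditive.comp_add]
      simp only [← Category.assoc, ← Preadditive.add_comp, biprod.total]
      simp
  -- The retraction `p₀` of `d` sends `δ` to `δ₂` only up to an extension induced from `δ₁`; the
  -- corrected retraction `p₀ + e ≫ r ≫ p₀` sends it to `δ₂` exactly.
  have hδ₂ : δ₂ = EExt.push 𝓔.E (p₀ + e ≫ r ≫ p₀) δ := by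
    have := congrArg (EExt.push 𝓔.E p₀) hr
    rw [EExt.push_sub, ← EExt.push_comp _ d, hdp, EExt.push_id, hδ₁, ← EExt.push_comp,
      ← EExt.push_comp] at this
    rw [add_push, this]
    abel
  have hsplit : 𝓔.s (0 : EExt 𝓔.E A₂ A₁) =
      TwoTermSeq.cls (s₀ - r ≫ p₀ ≫ d) (p₀ + e ≫ r ≫ p₀) := by
    refine s_zero_of_split (r := e) (t := d) ?_ ?_ ?_ hde0 ?_
    · simp [hse, hde0]
    · simp [hdp, reassoc_of% hde0]
    · simp [hsp, hdp, reassoc_of% hse, reassoc_of% hde0]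
    · rw [← hsum]
      simp only [Preadditive.comp_sub, Preadditive.add_comp, Category.assoc]
      abel
  -- The cone of `A₁ ⟶ H ⟶ M` therefore realizes `δ₂`, so it is `B₂`.
  obtain ⟨K, i₁, q, d', e', δ', -, -, -, hi, hd', -⟩ := 𝓔.et4 _ _ _ _ _ _ hsplit hk
  rw [← hδ₂, h₂] at hd'
  obtain ⟨b', -, -⟩ := TwoTermSeq.cls_eq_iff.1 hd'
  refine ⟨M, i₁, q ≫ b'.inv, i₂, p₁, ?_, ⟨_, hM⟩⟩
  simpa using Conflation.transport ⟨_, hi⟩ (Iso.refl _) b'.symm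

/-- Cobase change of an inflation along another inflation, dual to
`Conflation.exists_pullback`. -/
theorem Conflation.exists_pushout {A B₁ D₁ B₂ D₂ : C} {x₁ : A ⟶ B₁} {y₁ : B₁ ⟶ D₁}
    {x₂ : A ⟶ B₂} {y₂ : B₂ ⟶ D₂} (h₁ : 𝓔.Conflation x₁ y₁) (h₂ : 𝓔.Conflation x₂ y₂) :
    ∃ (M : C) (i₂ : B₂ ⟶ M) (p₁ : M ⟶ D₁) (i₁ : B₁ ⟶ M) (p₂ : M ⟶ D₂),
      𝓔.Conflation i₂ p₁ ∧ 𝓔.Conflation i₁ p₂ := by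
  obtain ⟨M, i₁, p₂, i₂, p₁, h, h'⟩ := Conflation.exists_pullback h₁.op h₂.op
  exact ⟨M.unop, p₂.unop, i₁.unop, p₁.unop, i₂.unop, h.unop, h'.unop⟩

/-- A conflation without nonzero extensions between its ends is a direct sum. -/
theorem Conflation.exists_split {A B D : C} {x : A ⟶ B} {y : B ⟶ D} (h : 𝓔.Conflation x y)
    (h₀ : ∀ δ : EExt 𝓔.E D A, δ = 0) : Nonempty (B ≅ A ⊞ D) :=
  let ⟨_, hδ⟩ := h
  let ⟨b, _⟩ := Extriangulation.exists_split hδ (h₀ _)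
  ⟨b⟩

/-! ### Projective and injective objects -/

theorem proj_iff {P : C} : 𝓔.proj P ↔ ∀ (A : C) (δ : EExt 𝓔.E P A), δ = 0 := by
  refine ⟨fun h A δ => ?_, fun h A B D x y hxy c => ?_⟩
  · obtain ⟨B, x, y, hδ⟩ := TwoTermSeq.exists_rep (𝓔.s δ)
    obtain ⟨t, ht⟩ := h x y ⟨_, hδ⟩ (𝟙 P)
    exact eq_zero_of_section hδ t ht
  · obtain ⟨δ, hδ⟩ := hxy
    exact exists_lifting hδ c (h _ _)

theorem eq_zero_of_retraction {A B D : C} {x : A ⟶ B} {y : B ⟶ D} {δ : EExt 𝓔.E D A}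
    (h : 𝓔.s δ = TwoTermSeq.cls x y) (r : B ⟶ A) (hr : x ≫ r = 𝟙 A) : δ = 0 := by
  rw [← EExt.push_id 𝓔.E δ, ← hr, EExt.push_comp, push_left_eq_zero h, EExt.push_zero]

theorem inj_iff {I : C} : 𝓔.inj I ↔ ∀ (D : C) (δ : EExt 𝓔.E D I), δ = 0 := by
  refine ⟨fun h D δ => ?_, fun h A B D x y hxy c => ?_⟩
  · obtain ⟨B, x, y, hδ⟩ := TwoTermSeq.exists_rep (𝓔.s δ)
    obtain ⟨t, ht⟩ := h x y ⟨_, hδ⟩ (𝟙 I)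
    exact eq_zero_of_retraction hδ t ht
  · obtain ⟨δ, hδ⟩ := hxy
    exact exists_extension hδ c (h _ _)

/-! ### Vanishing of higher extensions -/

/-- The vanishing of `𝔼ⁱ⁺¹(X, Y)`; as for `higherExt`, the index `i = 0` stands for `𝔼`. -/
def Vanishes (hP : 𝓔.EnoughProj) (i : ℕ) (X Y : C) : Prop :=
  ∀ e : higherExt hP i X Y, e = 0

/-- Dimension shifting: for conflations `K ⟶ P ⟶ X` and `Y ⟶ I ⟶ L` with `P` projective and `I`
injective, the groups `𝔼(K, Y)` and `𝔼(X, L)` vanish simultaneously. -/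
theorem forall_eq_zero_iff_of_proj_of_inj {K P X Y I L : C} {k : K ⟶ P} {p : P ⟶ X} {j : Y ⟶ I}
    {q : I ⟶ L} (hX : 𝓔.Conflation k p) (hP : 𝓔.proj P) (hY : 𝓔.Conflation j q)
    (hI : 𝓔.inj I) : (∀ e : EExt 𝓔.E K Y, e = 0) ↔ ∀ e : EExt 𝓔.E X L, e = 0 := by
  obtain ⟨κ, hκ⟩ := id hX
  obtain ⟨ι, hι⟩ := id hY
  constructor
  · intro h e
    obtain ⟨f, rfl⟩ := exists_push_eq hκ e (proj_iff.1 hP _ _)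
    obtain ⟨g, rfl⟩ := exists_lifting hι f (h _)
    obtain ⟨g', rfl⟩ := hI _ _ hX g
    rw [EExt.push_comp, EExt.push_comp, push_left_eq_zero hκ, EExt.push_zero, EExt.push_zero]
  · intro h e
    obtain ⟨f, rfl⟩ := exists_pull_eq hι e (inj_iff.1 hI _ _)
    obtain ⟨g, rfl⟩ := exists_extension hκ f (h _)
    obtain ⟨g', rfl⟩ := hP _ _ hY g
    rw [EExt.pull_comp, EExt.pull_comp, pull_right_eq_zero hι, EExt.pull_zero, EExt.pull_zero]

theorem syzygy_spec (hP : 𝓔.EnoughProj) (X : C) : ∃ (P : C) (k : syzygy hP X ⟶ P) (p : P ⟶ X),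
    𝓔.Conflation k p ∧ 𝓔.proj P :=
  (hP X).choose_spec

section

variable {hP : 𝓔.EnoughProj}

/-- Dimension shifting in the second variable. -/
theorem vanishes_succ_iff_right {i : ℕ} {X Y I L : C} {j : Y ⟶ I} {q : I ⟶ L}
    (h : 𝓔.Conflation j q) (hI : 𝓔.inj I) :
    Vanishes hP (i + 1) X Y ↔ Vanishes hP i X L :=
  let ⟨_, _, _, hX, hP'⟩ := syzygy_spec hP (iterSyzygy hP i X)
  forall_eq_zero_iff_of_proj_of_inj hX hP' h hI

/-- Dimension shifting in the first variable, along an arbitrary syzygy `K` of `X`. -/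
theorem vanishes_succ_iff_left (hE : 𝓔.EnoughInj) {i : ℕ} {K P X Y : C} {k : K ⟶ P} {p : P ⟶ X}
    (h : 𝓔.Conflation k p) (hP' : 𝓔.proj P) :
    Vanishes hP (i + 1) X Y ↔ Vanishes hP i K Y := by
  induction i generalizing Y with
  | zero =>
    obtain ⟨I, L, j, q, hY, hI⟩ := hE Y
    exact (vanishes_succ_iff_right hY hI).trans (forall_eq_zero_iff_of_proj_of_inj h hP' hY hI).symm
  | succ i ih =>
    obtain ⟨I, L, j, q, hY, hI⟩ := hE Y
    rw [vanishes_succ_iff_right hY hI, ih, vanishes_succ_iff_right hY hI]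

theorem vanishes_of_inj {i : ℕ} {X I : C} (hI : 𝓔.inj I) : Vanishes hP i X I :=
  inj_iff.1 hI _

theorem vanishes_of_proj (hE : 𝓔.EnoughInj) {i : ℕ} {P Y : C} (hP' : 𝓔.proj P) :
    Vanishes hP i P Y := by
  induction i generalizing Y with
  | zero => exact proj_iff.1 hP' _
  | succ i ih =>
    obtain ⟨I, L, j, q, hY, hI⟩ := hE Y
    exact (vanishes_succ_iff_right hY hI).2 ih

variable {A B D W : C} {x : A ⟶ B} {y : B ⟶ D}

theorem vanishes_middle_right {i : ℕ} (h : 𝓔.Conflation x y) (hA : Vanishes hP i W A)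
    (hD : Vanishes hP i W D) : Vanishes hP i W B := by
  intro e
  obtain ⟨δ, hδ⟩ := h
  obtain ⟨e', rfl⟩ := exists_push_left_eq hδ e (hD _)
  rw [hA e', EExt.push_zero]

theorem vanishes_cone_right {i : ℕ} (h : 𝓔.Conflation x y) (hB : Vanishes hP i W B)
    (hA : Vanishes hP (i + 1) W A) : Vanishes hP i W D := by
  intro e
  obtain ⟨δ, hδ⟩ := h
  obtain ⟨P, k, p, ⟨κ, hκ⟩, hP'⟩ := syzygy_spec hP (iterSyzygy hP i W)
  obtain ⟨f, rfl⟩ := exists_push_eq hκ e (proj_iff.1 hP' _ _)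
  obtain ⟨g, rfl⟩ := exists_lifting hδ f (hA _)
  rw [EExt.push_comp, hB (EExt.push 𝓔.E g κ), EExt.push_zero]

theorem vanishes_cocone_right {i : ℕ} (h : 𝓔.Conflation x y) (hD : Vanishes hP i W D)
    (hB : Vanishes hP (i + 1) W B) : Vanishes hP (i + 1) W A := by
  intro (e : EExt 𝓔.E (syzygy hP (iterSyzygy hP i W)) A)
  change e = 0
  obtain ⟨δ, hδ⟩ := id h
  obtain ⟨P, k, p, ⟨κ, hκ⟩, hP'⟩ := syzygy_spec hP (iterSyzygy hP i W)
  obtain ⟨f, rfl⟩ := exists_pull_eq hδ e (hB _)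
  obtain ⟨g, rfl⟩ := exists_extension hκ f (hD _)
  obtain ⟨g', rfl⟩ := hP' _ _ h g
  rw [EExt.pull_comp, EExt.pull_comp, pull_right_eq_zero hδ, EExt.pull_zero, EExt.pull_zero]

theorem vanishes_middle_left (hE : 𝓔.EnoughInj) {i : ℕ} (h : 𝓔.Conflation x y)
    (hA : Vanishes hP i A W) (hD : Vanishes hP i D W) : Vanishes hP i B W := by
  induction i generalizing W with
  | zero =>
    intro e
    obtain ⟨δ, hδ⟩ := h
    obtain ⟨e', rfl⟩ := exists_pull_right_eq hδ e (hA _)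
    exact (congrArg _ (hD e')).trans (EExt.pull_zero _ _)
  | succ i ih =>
    obtain ⟨I, L, j, q, hW, hI⟩ := hE W
    rw [vanishes_succ_iff_right hW hI] at *
    exact ih hA hD

theorem vanishes_cocone_left (hE : 𝓔.EnoughInj) {i : ℕ} (h : 𝓔.Conflation x y)
    (hB : Vanishes hP i B W) (hD : Vanishes hP (i + 1) D W) : Vanishes hP i A W := by
  induction i generalizing W with
  | zero =>
    intro e
    obtain ⟨I, L, j, q, hW, hI⟩ := hE W
    rw [vanishes_succ_iff_right hW hI] at hD
    obtain ⟨ι, hι⟩ := hW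
    obtain ⟨δ, hδ⟩ := h
    obtain ⟨f, rfl⟩ := exists_pull_eq hι e (inj_iff.1 hI _ _)
    obtain ⟨g, rfl⟩ := exists_extension hδ f (hD _)
    exact (EExt.pull_comp _ _ _ _).trans ((congrArg _ (hB _)).trans (EExt.pull_zero _ _))
  | succ i ih =>
    obtain ⟨I, L, j, q, hW, hI⟩ := hE W
    rw [vanishes_succ_iff_right hW hI] at *
    exact ih hB hD

theorem Vanishes.of_retract_left (hE : 𝓔.EnoughInj) {i : ℕ} {X X' : C} (s : X' ⟶ X) (r : X ⟶ X')
    (hsr : s ≫ r = 𝟙 X') (h : Vanishes hP i X W) : Vanishes hP i X' W := by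
  induction i generalizing W with
  | zero =>
    intro (δ : EExt 𝓔.E X' W)
    change δ = 0
    rw [← EExt.pull_id 𝓔.E δ, ← hsr, EExt.pull_comp]
    exact (congrArg _ (h _)).trans (EExt.pull_zero _ _)
  | succ i ih =>
    obtain ⟨I, L, j, q, hW, hI⟩ := hE W
    rw [vanishes_succ_iff_right hW hI] at *
    exact ih h

theorem Vanishes.of_retract_right {i : ℕ} {Y Y' : C} (s : Y' ⟶ Y) (r : Y ⟶ Y')
    (hsr : s ≫ r = 𝟙 Y') (h : Vanishes hP i W Y) : Vanishes hP i W Y' := by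
  intro δ
  rw [← EExt.push_id 𝓔.E δ, ← hsr, EExt.push_comp, h (EExt.push 𝓔.E s δ), EExt.push_zero]

end

end Extriangulation

end

/-! ### Objects with local endomorphism rings and radical morphisms -/

section

variable {C : Type u} [Category.{v} C] [Preadditive C]

theorem isIso_id_sub_comp_symm {X Y : C} {f : X ⟶ Y} {g : Y ⟶ X} (h : IsIso (𝟙 X - f ≫ g)) :
    IsIso (𝟙 Y - g ≫ f) := by
  let i := inv (𝟙 X - f ≫ g)
  have h₁ : i - f ≫ g ≫ i = 𝟙 X := by
    have := IsIso.hom_inv_id (𝟙 X - f ≫ g)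
    simpa only [Preadditive.sub_comp, Category.id_comp, Category.assoc] using this
  have h₂ : i - i ≫ f ≫ g = 𝟙 X := by
    have := IsIso.inv_hom_id (𝟙 X - f ≫ g)
    simpa only [Preadditive.comp_sub, Category.comp_id] using this
  refine ⟨𝟙 Y + g ≫ i ≫ f, ?_, ?_⟩
  · have := g ≫= h₁ =≫ f
    simp only [Preadditive.comp_sub, Preadditive.sub_comp, Category.assoc, Category.id_comp] at this
    simp only [Preadditive.comp_add, Preadditive.sub_comp, Category.assoc, Category.comp_id,
      Category.id_comp]
    rw [← sub_eq_zero, ← sub_eq_zero.2 this]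
    abel
  · have := g ≫= h₂ =≫ f
    simp only [Preadditive.comp_sub, Preadditive.sub_comp, Category.assoc, Category.id_comp] at this
    simp only [Preadditive.add_comp, Preadditive.comp_sub, Category.assoc, Category.comp_id,
      Category.id_comp]
    rw [← sub_eq_zero, ← sub_eq_zero.2 this]
    abel

/-- A morphism in the Jacobson radical of the category. -/
def IsInRadical {X Y : C} (f : X ⟶ Y) : Prop :=
  ∀ g : Y ⟶ X, IsIso (𝟙 X - f ≫ g)

theorem IsInRadical.comp_right {X Y Z : C} {f : X ⟶ Y} (hf : IsInRadical f) (h : Y ⟶ Z) :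
    IsInRadical (f ≫ h) := fun g => by
  simpa using hf (h ≫ g)

theorem IsInRadical.comp_left {X Y Z : C} {f : Y ⟶ Z} (hf : IsInRadical f) (h : X ⟶ Y) :
    IsInRadical (h ≫ f) := fun g => by
  have := isIso_id_sub_comp_symm (f := f ≫ g) (g := h) (by simpa using hf (g ≫ h))
  simpa using this

theorem isInRadical_zero (X Y : C) : IsInRadical (0 : X ⟶ Y) := fun g => by
  simp only [zero_comp, sub_zero]
  infer_instance

theorem IsInRadical.add {X Y : C} {f f' : X ⟶ Y} (hf : IsInRadical f) (hf' : IsInRadical f') :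
    IsInRadical (f + f') := fun g => by
  have := hf g
  have := hf' (g ≫ inv (𝟙 X - f ≫ g))
  have h : 𝟙 X - (f + f') ≫ g =
      (𝟙 X - f' ≫ g ≫ inv (𝟙 X - f ≫ g)) ≫ (𝟙 X - f ≫ g) := by
    rw [Preadditive.sub_comp]
    simp only [Category.assoc, IsIso.inv_hom_id, Category.comp_id, Category.id_comp,
      Preadditive.add_comp]
    abel
  rw [h]
  infer_instance

theorem isInRadical_sum {X Y : C} {ι : Type*} (s : Finset ι) (f : ι → (X ⟶ Y))
    (h : ∀ i ∈ s, IsInRadical (f i)) : IsInRadical (∑ i ∈ s, f i) :=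
  Finset.sum_induction _ _ (fun _ _ => IsInRadical.add) (isInRadical_zero X Y) h

theorem isIso_or_isIso_of_add_eq_id {F : C} (hF : IsLocalRing (End F)) {a b : F ⟶ F}
    (h : a + b = 𝟙 F) : IsIso a ∨ IsIso b := by
  rw [← isUnit_iff_isIso, ← isUnit_iff_isIso]
  exact IsLocalRing.isUnit_or_isUnit_of_add_one (R := End F) h

theorem exists_isIso_of_sum {F : C} (hF : IsLocalRing (End F)) {ι : Type*} (s : Finset ι)
    (f : ι → (F ⟶ F)) (h : IsIso (∑ i ∈ s, f i)) : ∃ i ∈ s, IsIso (f i) := by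
  classical
  induction s using Finset.induction_on with
  | empty =>
    have : 𝟙 F = 0 := by
      rw [← IsIso.hom_inv_id (∑ i ∈ (∅ : Finset ι), f i)]
      exact (Finset.sum_empty =≫ _).trans zero_comp
    exact absurd this (one_ne_zero (α := End F))
  | insert i s hi ih =>
    have h' : f i ≫ inv (∑ i ∈ insert i s, f i) +
        (∑ i ∈ s, f i) ≫ inv (∑ i ∈ insert i s, f i) = 𝟙 F := by
      rw [← Preadditive.add_comp, ← Finset.sum_insert hi, IsIso.hom_inv_id]
    rcases isIso_or_isIso_of_add_eq_id hF h' with h₁ | h₁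
    · exact ⟨i, by simp, IsIso.of_isIso_comp_right _ (inv (∑ i ∈ insert i s, f i))⟩
    · obtain ⟨j, hj, hj'⟩ := ih (IsIso.of_isIso_comp_right _ (inv (∑ i ∈ insert i s, f i)))
      exact ⟨j, by simp [hj], hj'⟩

/-- A nonzero retract of an object with local endomorphism ring is the whole object. -/
theorem isIso_of_isIso_comp {F F' : C} (hF : IsLocalRing (End F)) (hF' : IsLocalRing (End F'))
    {f : F ⟶ F'} {g : F' ⟶ F} (h : IsIso (f ≫ g)) : IsIso f := by
  obtain ⟨g', hg'⟩ : ∃ g' : F' ⟶ F, f ≫ g' = 𝟙 F :=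
    ⟨g ≫ inv (f ≫ g), by rw [← Category.assoc, IsIso.hom_inv_id]⟩
  rcases isIso_or_isIso_of_add_eq_id hF' (a := g' ≫ f) (b := 𝟙 F' - g' ≫ f) (by abel) with h | h
  · have : IsSplitMono f := ⟨⟨⟨g', hg'⟩⟩⟩
    have : IsSplitEpi f := ⟨⟨⟨inv (g' ≫ f) ≫ g', by simp⟩⟩⟩
    exact isIso_of_mono_of_isSplitEpi f
  · have h₀ : f ≫ (𝟙 F' - g' ≫ f) = 0 := by simp [reassoc_of% hg']
    have h₁ : f = 0 := by rwa [← cancel_mono (𝟙 F' - g' ≫ f), zero_comp]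
    rw [h₁, zero_comp] at hg'
    exact absurd hg'.symm (one_ne_zero (α := End F))

theorem isInRadical_of_not_isIso {F F' : C} (hF : IsLocalRing (End F))
    (hF' : IsLocalRing (End F')) {f : F ⟶ F'} (h : ¬ IsIso f) : IsInRadical f := fun g =>
  (isIso_or_isIso_of_add_eq_id hF (a := f ≫ g) (b := 𝟙 F - f ≫ g) (by abel)).resolve_left
    fun h' => h (isIso_of_isIso_comp hF hF' h')

end

/-! ### Splitting off direct summands in a Krull-Schmidt category -/

section

variable {C : Type u} [Category.{v} C] [Preadditive C] [HasFiniteBiproducts C]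

/-- `X` is a direct sum of `m` objects with local endomorphism rings. -/
def IsSumOfLocals (m : ℕ) (X : C) : Prop :=
  ∃ F : Fin m → C, (∀ i, IsLocalRing (End (F i))) ∧ Nonempty (X ≅ ⨁ F)

theorem IsSumOfLocals.of_iso {m : ℕ} {X Y : C} (h : IsSumOfLocals m X) (e : X ≅ Y) :
    IsSumOfLocals m Y :=
  let ⟨F, hF, ⟨e'⟩⟩ := h
  ⟨F, hF, ⟨e.symm ≪≫ e'⟩⟩

/-- A retraction onto an object with local endomorphism ring splits off, and the complement is
a direct sum of one local object less. -/
theorem IsSumOfLocals.exists_complement {m : ℕ} {X L : C} (hX : IsSumOfLocals m X)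
    (hL : IsLocalRing (End L)) {s : L ⟶ X} {p : X ⟶ L} (hsp : s ≫ p = 𝟙 L) :
    ∃ (m' : ℕ) (X' : C) (k : X' ⟶ X) (r : X ⟶ X') (t : L ⟶ X), m = m' + 1 ∧ IsSumOfLocals m' X' ∧
      k ≫ r = 𝟙 X' ∧ t ≫ p = 𝟙 L ∧ k ≫ p = 0 ∧ t ≫ r = 0 ∧ r ≫ k + p ≫ t = 𝟙 X := by
  obtain ⟨F, hF, ⟨e⟩⟩ := hX
  -- Some component `F i ⟶ L` of `p` is invertible; `l` is the inclusion of `F i`, and the other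
  -- summands form a complement of it.
  obtain ⟨i, -, hi⟩ := exists_isIso_of_sum hL Finset.univ
    (fun i => (s ≫ e.hom ≫ biproduct.π F i) ≫ biproduct.ι F i ≫ e.inv ≫ p) (by
      have h := s ≫= e.hom ≫= (biproduct.total (f := F) =≫ e.inv) =≫ p
      simp only [Preadditive.comp_sum, Preadditive.sum_comp, Category.assoc, Category.id_comp,
        e.hom_inv_id_assoc, hsp] at h
      simp only [Category.assoc, h]
      infer_instance)
  have h₁ := isIso_of_isIso_comp hL (hF i) hi
  have h₂ : IsIso (biproduct.ι F i ≫ e.inv ≫ p) := 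
    IsIso.of_isIso_comp_left (s ≫ e.hom ≫ biproduct.π F i) _
  obtain _ | m := m
  · exact i.elim0
  let X' := ⨁ fun j => F (i.succAbove j)
  let j : X' ⟶ X := biproduct.desc fun j => biproduct.ι F (i.succAbove j) ≫ e.inv
  let q : X ⟶ X' := biproduct.lift fun j => e.hom ≫ biproduct.π F (i.succAbove j)
  let l := biproduct.ι F i ≫ e.inv
  have hlp : IsIso (l ≫ p) := by simpa [l] using h₂
  let t := inv (l ≫ p) ≫ l
  have hjq : j ≫ q = 𝟙 X' := by
    ext a b
    by_cases hab : a = b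
    · subst hab
      simp [j, q]
    · have h := biproduct.ι_π_ne F (i.succAbove_right_injective.ne (Ne.symm hab))
      have h' := biproduct.ι_π_ne (fun j => F (i.succAbove j)) (Ne.symm hab)
      simp [j, q, h, h']
  have hlq : l ≫ q = 0 := by
    ext a
    simp [l, q]
  have htp : t ≫ p = 𝟙 L := by simp only [t, Category.assoc, IsIso.inv_hom_id]
  have htot : (e.hom ≫ biproduct.π F i) ≫ l + q ≫ j = 𝟙 X := by
    have h := e.hom ≫= biproduct.total (f := F) =≫ e.inv
    rw [Fin.sum_univ_succAbove _ i] at h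
    simpa [q, j, l, biproduct.lift_desc, Preadditive.comp_sum, Preadditive.sum_comp] using h
  have hlpt : l ≫ (𝟙 X - p ≫ t) = 0 := by
    have := IsIso.hom_inv_id_assoc (l ≫ p) l
    rw [Category.assoc] at this
    simp [t, this]
  refine ⟨m, X', j - j ≫ p ≫ t, q, t, rfl, ⟨_, fun j => hF _, ⟨Iso.refl _⟩⟩, ?_, htp, ?_, ?_, ?_⟩
  · simp [t, hjq, hlq]
  · simp [htp]
  · simp [t, hlq]
  · have h := htot =≫ (𝟙 X - p ≫ t)
    rw [Preadditive.add_comp, Category.assoc, hlpt, comp_zero, zero_add, Category.assoc,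
      Preadditive.comp_sub j, Category.comp_id, Category.id_comp] at h
    rw [h]
    abel

/-- `a` is left minimal: every endomorphism of its target that fixes `a` is invertible. -/
def IsLeftMinimal {A X : C} (a : A ⟶ X) : Prop :=
  ∀ φ : X ⟶ X, a ≫ φ = a → IsIso φ

/-- If `a` is not left minimal, then it misses a summand of its target with local endomorphism
ring. -/
theorem IsSumOfLocals.exists_of_not_isLeftMinimal {m : ℕ} {A X : C} (hX : IsSumOfLocals m X)
    {a : A ⟶ X} (ha : ¬ IsLeftMinimal a) :
    ∃ (L : C) (s : L ⟶ X) (p : X ⟶ L), IsLocalRing (End L) ∧ s ≫ p = 𝟙 L ∧ a ≫ p = 0 := by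
  obtain ⟨F, hF, ⟨e⟩⟩ := hX
  simp only [IsLeftMinimal, not_forall] at ha
  obtain ⟨φ, hφ, hφ'⟩ := ha
  let ψ := 𝟙 X - φ
  -- `a` kills `ψ`, which is not radical, so that some component of `ψ` is invertible.
  have hψ : ¬ IsInRadical ψ := fun h => hφ' (by simpa [ψ] using h (𝟙 X))
  obtain ⟨i, j, hij⟩ : ∃ i j, IsIso (biproduct.ι F i ≫ e.inv ≫ ψ ≫ e.hom ≫ biproduct.π F j) := by
    by_contra! hn
    refine hψ ?_
    have h : ψ = ∑ i, ∑ j, (e.hom ≫ biproduct.π F i) ≫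
        (biproduct.ι F i ≫ e.inv ≫ ψ ≫ e.hom ≫ biproduct.π F j) ≫ biproduct.ι F j ≫ e.inv := by
      have h := e.hom ≫= biproduct.total (f := F) =≫ e.inv
      simp only [Preadditive.comp_sum, Preadditive.sum_comp, Category.assoc, Category.id_comp,
        e.hom_inv_id] at h
      conv_lhs => rw [← Category.comp_id ψ, ← Category.id_comp ψ, ← h]
      simp only [Preadditive.comp_sum, Preadditive.sum_comp, Category.assoc]
      exact Finset.sum_comm
    rw [h]
    exact isInRadical_sum _ _ fun i _ => isInRadical_sum _ _ fun j _ =>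
      ((isInRadical_of_not_isIso (hF i) (hF j) (hn i j)).comp_right _).comp_left _
  refine ⟨F i, biproduct.ι F i ≫ e.inv, ψ ≫ (e.hom ≫ biproduct.π F j) ≫
    inv (biproduct.ι F i ≫ e.inv ≫ ψ ≫ e.hom ≫ biproduct.π F j), hF i, ?_, ?_⟩
  · simpa only [Category.assoc] using
      IsIso.hom_inv_id (biproduct.ι F i ≫ e.inv ≫ ψ ≫ e.hom ≫ biproduct.π F j)
  · rw [← Category.assoc, Preadditive.comp_sub, hφ]
    simp

end

section

variable {C : Type u} [Category.{v} C] [Preadditive C] [HasFiniteBiproducts C]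

namespace Extriangulation

variable {𝓔 : Extriangulation.{w} C}

/-! ### Minimal left approximations and Wakamatsu's lemma -/

theorem Conflation.exists_comp_inflation {A B D G F : C} {f : A ⟶ B} {f' : B ⟶ D} {g : B ⟶ G}
    {g' : G ⟶ F} (h : 𝓔.Conflation f f') (h' : 𝓔.Conflation g g') :
    ∃ (H : C) (k : G ⟶ H), 𝓔.Conflation (f ≫ g) k := by
  obtain ⟨δ, h⟩ := h
  obtain ⟨δ', h'⟩ := h'
  obtain ⟨H, _, k, d, e, δ'', rfl, -, -, h'', -⟩ := 𝓔.et4 _ _ _ _ _ _ h h'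
  exact ⟨H, k, δ'', h''⟩

open scoped ZeroObject in
theorem conflation_id (A : C) : 𝓔.Conflation (𝟙 A) (0 : A ⟶ 0) :=
  ⟨0, s_zero_of_split (r := 𝟙 A) (t := 0) (by simp) (by simp) (by simp) (by simp) (by simp)⟩

/-- If `j` is an inflation, then so is `(g, j)` for every `g`. -/
theorem Conflation.exists_lift_inflation {A I L Y : C} {j : A ⟶ I} {q : I ⟶ L}
    (h : 𝓔.Conflation j q) (g : A ⟶ Y) :
    ∃ (Z : C) (y : Y ⊞ I ⟶ Z), 𝓔.Conflation (biprod.lift g j) y := by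
  -- `(g, j)` is the composite of the split inflation `(g, 1) : A ⟶ Y ⊞ A` and `1 ⊕ j`.
  have h₁ : 𝓔.Conflation (biprod.lift g (𝟙 A)) (biprod.fst - biprod.snd ≫ g : Y ⊞ A ⟶ Y) :=
    ⟨0, s_zero_of_split (r := biprod.snd) (t := biprod.inl) (by simp) (by simp) (by simp) (by simp)
      (by ext <;> simp)⟩
  obtain ⟨δ, hδ⟩ := h
  obtain ⟨δ', hδ'⟩ := conflation_id (𝓔 := 𝓔) Y
  obtain ⟨Z, k, hk⟩ := h₁.exists_comp_inflation ⟨_, 𝓔.s_sum _ _ _ _ _ _ hδ' hδ⟩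
  have hlift : biprod.lift g (𝟙 A) ≫ biprod.map (𝟙 Y) j = biprod.lift g j := by ext <;> simp
  exact ⟨Z, k, hlift ▸ hk⟩

/-- A left `P`-approximation. -/
def IsLeftApprox (P : ObjectProperty C) {A Y : C} (g : A ⟶ Y) : Prop :=
  P Y ∧ ∀ X, P X → ∀ f : A ⟶ X, ∃ k : Y ⟶ X, g ≫ k = f

/-- If a left approximation which is an inflation misses a direct summand `L` of its target, then
`L` can be split off from the whole conflation. -/
theorem exists_leftMinimal_of_isSumOfLocals (hKS : IsKrullSchmidt C) {P : ObjectProperty C}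
    (hP : ClosedUnderSummands P) (m : ℕ) {A X Z : C} {a : A ⟶ X} {y : X ⟶ Z}
    (hX : IsSumOfLocals m X) (h : 𝓔.Conflation a y) (ha : IsLeftApprox P a) :
    ∃ (X' Z' : C) (a' : A ⟶ X') (y' : X' ⟶ Z'), 𝓔.Conflation a' y' ∧ IsLeftApprox P a' ∧
      IsLeftMinimal a' := by
  induction m generalizing X Z with
  | zero =>
    by_cases hmin : IsLeftMinimal a
    · exact ⟨X, Z, a, y, h, ha, hmin⟩
    · obtain ⟨L, s, p, hL, hsp, -⟩ := hX.exists_of_not_isLeftMinimal hmin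
      obtain ⟨m', _, _, _, _, hm, -⟩ := hX.exists_complement hL hsp
      omega
  | succ m ih =>
    by_cases hmin : IsLeftMinimal a
    · exact ⟨X, Z, a, y, h, ha, hmin⟩
    obtain ⟨L, s, p, hL, hsp, hap⟩ := hX.exists_of_not_isLeftMinimal hmin
    obtain ⟨m', X', k', r', t', hm, hX', hkr', htp', hkp', htr', hsum'⟩ :=
      hX.exists_complement hL hsp
    obtain rfl : m = m' := by omega
    obtain ⟨p', rfl⟩ : ∃ p', y ≫ p' = p := by
      obtain ⟨δ, hδ⟩ := h
      exact exists_desc hδ p hap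
    obtain ⟨_, F, hF, ⟨e⟩⟩ := hKS Z
    have hZ : IsSumOfLocals _ Z := ⟨F, hF, ⟨e⟩⟩
    obtain ⟨_, Z', k'', r'', t'', -, -, hkr, htp, hkp, htr, hsum⟩ :=
      hZ.exists_complement hL (s := s ≫ y) (p := p') (by simpa using hsp)
    obtain ⟨H, d, e', k, hde, hk, rfl⟩ :=
      h.comp_deflation ⟨_, s_zero_of_split hkr htp hkp htr hsum⟩
    obtain ⟨δ, hδ⟩ := hk
    -- `H` and `X'` are both complements of `L` in `X`.
    obtain ⟨b, hb₁, hb₂⟩ := exists_split hδ (eq_zero_of_section hδ s hsp)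
    have hmono : IsSplitMono k := ⟨⟨⟨b.hom ≫ biprod.fst, by simp [reassoc_of% hb₁]⟩⟩⟩
    obtain ⟨l, hl⟩ := exists_lift hδ k' hkp'
    have hH : H ≅ X' :=
      { hom := k ≫ r'
        inv := l
        hom_inv_id := by
          rw [← cancel_mono k, Category.assoc, Category.assoc, hl, Category.id_comp]
          have := k ≫= hsum'
          simpa [reassoc_of% (comp_eq_zero hδ)] using this
        inv_hom_id := by rw [reassoc_of% hl, hkr'] }
    refine ih (hX'.of_iso hH.symm) hde ⟨hP b ha.1, fun X₁ hX₁ f => ?_⟩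
    obtain ⟨g, hg⟩ := ha.2 X₁ hX₁ f
    exact ⟨k ≫ g, by simpa using hg⟩

theorem IsCoresolving.exists_leftMinimal (hKS : IsKrullSchmidt C) (hE : 𝓔.EnoughInj)
    {P : ObjectProperty C} (hP : 𝓔.IsCoresolving P) (hf : IsCovariantlyFinite P)
    (hs : ClosedUnderSummands P) (A : C) :
    ∃ (X Z : C) (a : A ⟶ X) (y : X ⟶ Z), 𝓔.Conflation a y ∧ IsLeftApprox P a ∧
      IsLeftMinimal a := by
  obtain ⟨Y, g, hY, hg⟩ := hf A
  obtain ⟨I, L, j, q, hj, hI⟩ := hE A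
  obtain ⟨Z, y, hy⟩ := hj.exists_lift_inflation g
  obtain ⟨m, F, hF, ⟨e⟩⟩ := hKS (Y ⊞ I)
  refine exists_leftMinimal_of_isSumOfLocals hKS hs m ⟨F, hF, ⟨e⟩⟩ hy
    ⟨hP.additive.sum_mem hY (hP.inj_le _ hI), fun X hX f => ?_⟩
  obtain ⟨k, rfl⟩ := hg X hX f
  exact ⟨biprod.fst ≫ k, by simp⟩

/-- Wakamatsu's lemma: the cone of a minimal left approximation by an extension closed
subcategory is left orthogonal to it. -/
theorem eq_zero_of_isLeftMinimal {P : ObjectProperty C}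
    (hP : ∀ {A B D : C} (x : A ⟶ B) (y : B ⟶ D), 𝓔.Conflation x y → P A → P D → P B)
    {A X Z : C} {a : A ⟶ X} {y : X ⟶ Z} (h : 𝓔.Conflation a y) (ha : IsLeftApprox P a)
    (hmin : IsLeftMinimal a) {Y : C} (hY : P Y) (ε : EExt 𝓔.E Z Y) : ε = 0 := by
  obtain ⟨δ, hδ⟩ := h
  have hε : EExt.pull 𝓔.E y ε = 0 := by
    obtain ⟨U, i, p, hU⟩ := TwoTermSeq.exists_rep (𝓔.s (EExt.pull 𝓔.E y ε))
    -- The pull-back of `ε` to `X` splits: `a` lifts to `U`, and its lift extends along `a`.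
    obtain ⟨a', ha'⟩ := exists_lifting hU a (by
      rw [← EExt.pull_comp, comp_eq_zero hδ, zero_pull])
    obtain ⟨g, rfl⟩ := ha.2 U (hP i p ⟨_, hU⟩ hY ha.1) a'
    have := hmin (g ≫ p) (by simpa using ha')
    exact eq_zero_of_section hU (inv (g ≫ p) ≫ g) (by simp)
  obtain ⟨f, rfl⟩ := exists_push_eq hδ ε hε
  obtain ⟨g, rfl⟩ := ha.2 Y hY f
  rw [EExt.push_comp, push_left_eq_zero hδ, EExt.push_zero]

/-! ### Perpendicular subcategories -/

section

variable {hP : 𝓔.EnoughProj} {P : ObjectProperty C}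

theorem vanishes_of_isZero_left (hE : 𝓔.EnoughInj) {i : ℕ} {X Y : C} (hX : IsZero X) :
    Vanishes hP i X Y :=
  vanishes_of_proj hE (proj_iff.2 fun _ => 𝓔.eq_zero_of_isZero_left hX)

theorem rightPerp_closedUnderSummands : ClosedUnderSummands (rightPerp hP P) :=
  fun {_ _ _} e hZ W hW i =>
    Vanishes.of_retract_right (biprod.inl ≫ e.inv) (e.hom ≫ biprod.fst) (by simp) (hZ W hW i)

theorem leftPerp_closedUnderSummands (hE : 𝓔.EnoughInj) : ClosedUnderSummands (leftPerp hP P) :=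
  fun {_ _ _} e hZ W hW i =>
    Vanishes.of_retract_left hE (biprod.inl ≫ e.inv) (e.hom ≫ biprod.fst) (by simp) (hZ W hW i)

theorem rightPerp_isCoresolving : 𝓔.IsCoresolving (rightPerp hP P) where
  additive :=
    { iso_closed := fun e hX W hW i =>
        Vanishes.of_retract_right e.inv e.hom (by simp) (hX W hW i)
      zero_mem := fun hZ _ _ _ => 𝓔.eq_zero_of_isZero_right hZ
      sum_mem := fun hX hY W hW i =>
        vanishes_middle_right (conflation_zero _ _) (hX W hW i) (hY W hW i) }
  inj_le := fun _ hI _ _ _ => vanishes_of_inj hI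
  ext_closed := fun _ _ h hA hD W hW i => vanishes_middle_right h (hA W hW i) (hD W hW i)
  cone_closed := fun _ _ h hA hB W hW i => vanishes_cone_right h (hB W hW i) (hA W hW (i + 1))

theorem leftPerp_isAdditiveSubcategory (hE : 𝓔.EnoughInj) :
    IsAdditiveSubcategory (leftPerp hP P) where
  iso_closed := fun e hX W hW i => Vanishes.of_retract_left hE e.inv e.hom (by simp) (hX W hW i)
  zero_mem := fun hZ _ _ _ => vanishes_of_isZero_left hE hZ
  sum_mem := fun hX hY W hW i =>
    vanishes_middle_left hE (conflation_zero _ _) (hX W hW i) (hY W hW i)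

/-! ### Projective dimension and coresolutions -/

theorem exists_hat_of_projDim_le {n : ℕ} {A : C} (h : 𝓔.projDim A ≤ n) :
    ∃ m ≤ n, 𝓔.hat 𝓔.proj m A := by
  by_contra! hn
  have : ((n + 1 : ℕ) : ℕ∞) ≤ 𝓔.projDim A :=
    le_iInf₂ fun m hm => by
      by_contra! hlt
      exact hn m (Nat.lt_succ_iff.1 (by exact_mod_cast hlt)) hm
  have := this.trans h
  norm_cast at this
  omega

theorem vanishes_of_hat (hE : 𝓔.EnoughInj) {m j : ℕ} (hmj : m ≤ j) {X Y : C}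
    (h : 𝓔.hat 𝓔.proj m X) : Vanishes hP j X Y := by
  induction m generalizing X j with
  | zero => exact vanishes_of_proj hE h
  | succ m ih =>
    obtain ⟨K, T, x, y, hxy, hT, hK⟩ := h
    obtain ⟨j, rfl⟩ : ∃ i, j = i + 1 := ⟨j - 1, by omega⟩
    exact (vanishes_succ_iff_left hE hxy hT).2 (ih (by omega) hK)

theorem hat_of_vanishes (hE : 𝓔.EnoughInj) {n : ℕ} {X : C} (h : ∀ Y, Vanishes hP n X Y) :
    𝓔.hat 𝓔.proj n X := by
  induction n generalizing X with
  | zero => exact proj_iff.2 h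
  | succ n ih =>
    obtain ⟨T, k, p, hX, hT⟩ := syzygy_spec hP X
    exact ⟨_, T, k, p, hX, hT, ih fun Y => (vanishes_succ_iff_left hE hX hT).1 (h Y)⟩

/-- The coresolution consists of `n` injectives followed by the `n`-th cosyzygy of `A`. -/
theorem check_rightPerp_of_vanishes (hE : 𝓔.EnoughInj) {n : ℕ} {A : C}
    (h : ∀ X, P X → ∀ i, n ≤ i → Vanishes hP i X A) : 𝓔.check (rightPerp hP P) n A := by
  induction n generalizing A with
  | zero => exact fun X hX i => h X hX i (Nat.zero_le i)
  | succ n ih =>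
    obtain ⟨I, L, j, q, hA, hI⟩ := hE A
    exact ⟨I, L, j, q, hA, fun _ _ _ => vanishes_of_inj hI, ih fun X hX i hi =>
      (vanishes_succ_iff_right hA hI).1 (h X hX (i + 1) (by omega))⟩

/-- Dimension shifting along a `P`-coresolution. -/
theorem vanishes_of_check {n j : ℕ} (hnj : n ≤ j) {W A : C} (hW : leftPerp hP P W)
    (h : 𝓔.check P n A) : Vanishes hP j W A := by
  induction n generalizing A j with
  | zero => exact hW A h j
  | succ n ih =>
    obtain ⟨X, K, x, y, hxy, hX, hK⟩ := h
    obtain ⟨j, rfl⟩ : ∃ i, j = i + 1 := ⟨j - 1, by omega⟩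
    exact vanishes_cocone_right hxy (ih (by omega) hK) (hW X hX (j + 1))

/-- An Auslander-Buchweitz approximation: if `T ⊆ ^⊥P` is a generator for `P`, then every object
with a finite `P`-coresolution admits an inflation into an object of `P` with cone in `^⊥P`. -/
theorem exists_approx_of_check (hE : 𝓔.EnoughInj) {T : ObjectProperty C}
    (hext : ∀ {A B D : C} (x : A ⟶ B) (y : B ⟶ D), 𝓔.Conflation x y → P A → P D → P B)
    (hT : 𝓔.IsGeneratorFor T P) (hTP : T ≤ leftPerp hP P) {n : ℕ} {A : C}
    (h : 𝓔.check P n A) : ∃ (X Z : C) (x : A ⟶ X) (y : X ⟶ Z), 𝓔.Conflation x y ∧ P X ∧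
      leftPerp hP P Z := by
  induction n generalizing A with
  | zero =>
    exact ⟨A, _, 𝟙 A, 0, conflation_id A, h, fun _ _ _ =>
      vanishes_of_isZero_left hE (isZero_zero C)⟩
  | succ n ih =>
    obtain ⟨X₀, K, x₀, y₀, h₀, hX₀, hK⟩ := h
    obtain ⟨X₁, Z₁, x₁, y₁, h₁, hX₁, hZ₁⟩ := ih hK
    obtain ⟨Y, T₁, x₂, y₂, h₂, hT₁, hY⟩ := hT.2 X₁ hX₁
    -- `W` is the cocone of `T₁ ⟶ X₁ ⟶ Z₁`, and `U` the pullback of `X₀ ⟶ K` and `W ⟶ K`.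
    obtain ⟨W, d, e, k, hde, hk, -⟩ := h₂.comp_deflation h₁
    obtain ⟨U, i₁, p₂, i₂, p₁, hU, hU'⟩ := h₀.exists_pullback hde
    exact ⟨U, W, i₁, p₂, hU, hext _ _ hU' hY hX₀, fun V hV i =>
      vanishes_cocone_left hE hk (hTP _ hT₁ V hV i) (hZ₁ V hV (i + 1))⟩

/-! ### From tilting subcategories to coresolving subcategories -/

variable {n : ℕ}

theorem IsTilting.le_leftPerp : P ≤ leftPerp hP (rightPerp hP P) :=
  fun X hX _ hY i => hY X hX i

theorem IsTilting.vanishes (hE : 𝓔.EnoughInj) (hT : IsTilting hP n P) {X Y : C} (hX : P X)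
    {i : ℕ} (hi : n ≤ i) : Vanishes hP i X Y :=
  let ⟨_, hm, h⟩ := exists_hat_of_projDim_le (hT.projDim_le X hX)
  vanishes_of_hat hE (hm.trans hi) h

theorem IsTilting.check_eq_top (hE : 𝓔.EnoughInj) (hT : IsTilting hP n P) :
    𝓔.check (rightPerp hP P) n = ⊤ :=
  eq_top_iff.2 fun _ _ => check_rightPerp_of_vanishes hE fun _ hX _ hi => hT.vanishes hE hX hi

theorem IsTilting.isCovariantlyFinite (hE : 𝓔.EnoughInj) (hT : IsTilting hP n P) :
    IsCovariantlyFinite (rightPerp hP P) := by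
  intro A
  obtain ⟨X, Z, x, y, ⟨δ, hδ⟩, hX, hZ⟩ := exists_approx_of_check hE
    rightPerp_isCoresolving.ext_closed hT.generator IsTilting.le_leftPerp
    (hT.check_eq_top hE ▸ trivial : 𝓔.check (rightPerp hP P) n A)
  exact ⟨X, x, hX, fun Y hY f => exists_extension hδ f (hZ Y hY 0 _)⟩

theorem IsTilting.leftPerp_inf_rightPerp (hT : IsTilting hP n P) :
    leftPerp hP (rightPerp hP P) ⊓ rightPerp hP P = P := by
  refine le_antisymm ?_ (le_inf IsTilting.le_leftPerp hT.generator.1)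
  rintro Y ⟨hY, hY'⟩
  obtain ⟨Y', X, x, y, h, hX, hY''⟩ := hT.generator.2 Y hY'
  obtain ⟨e⟩ := h.exists_split (hY Y' hY'' 0)
  exact hT.summands (e ≪≫ biprod.braiding _ _) hX

/-! ### From coresolving subcategories to tilting subcategories -/

theorem IsCoresolving.mem_leftPerp_of_forall_eq_zero (hE : 𝓔.EnoughInj)
    (hX : 𝓔.IsCoresolving P) {Z : C} (hZ : ∀ Y, P Y → ∀ ε : EExt 𝓔.E Z Y, ε = 0) :
    leftPerp hP P Z := by
  intro Y hY i
  induction i generalizing Y with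
  | zero => exact hZ Y hY
  | succ i ih =>
    obtain ⟨I, L, j, q, h, hI⟩ := hE Y
    exact (vanishes_succ_iff_right h hI).2 (ih L (hX.cone_closed j q h hY (hX.inj_le I hI)))

/-- A left approximation by a coresolving subcategory can be completed to a conflation with cone
in the left perpendicular subcategory. -/
theorem IsCoresolving.exists_conflation (hKS : IsKrullSchmidt C) (hE : 𝓔.EnoughInj)
    (hX : 𝓔.IsCoresolving P) (hf : IsCovariantlyFinite P) (hs : ClosedUnderSummands P) (A : C) :
    ∃ (X Z : C) (a : A ⟶ X) (y : X ⟶ Z), 𝓔.Conflation a y ∧ P X ∧ leftPerp hP P Z := by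
  obtain ⟨X, Z, a, y, h, ha, hmin⟩ := hX.exists_leftMinimal hKS hE hf hs A
  exact ⟨X, Z, a, y, h, ha.1, hX.mem_leftPerp_of_forall_eq_zero hE fun Y hY =>
    eq_zero_of_isLeftMinimal hX.ext_closed h ha hmin hY⟩

theorem IsCoresolving.isTilting (hKS : IsKrullSchmidt C) (hE : 𝓔.EnoughInj)
    (hX : 𝓔.IsCoresolving P) (hf : IsCovariantlyFinite P) (hs : ClosedUnderSummands P)
    (hn : 𝓔.check P n = ⊤) (hperp : rightPerp hP (leftPerp hP P ⊓ P) = P) :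
    IsTilting hP n (leftPerp hP P ⊓ P) where
  additive :=
    have h := leftPerp_isAdditiveSubcategory (hP := hP) (P := P) hE
    { iso_closed := fun e hX' => ⟨h.iso_closed e hX'.1, hX.additive.iso_closed e hX'.2⟩
      zero_mem := fun hZ => ⟨h.zero_mem hZ, hX.additive.zero_mem hZ⟩
      sum_mem := fun h₁ h₂ => ⟨h.sum_mem h₁.1 h₂.1, hX.additive.sum_mem h₁.2 h₂.2⟩ }
  summands := fun {_ _ _} e hZ => ⟨leftPerp_closedUnderSummands hE e hZ.1, hs e hZ.2⟩
  projDim_le := fun W hW => iInf₂_le n (hat_of_vanishes (hP := hP) hE fun Y =>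
    vanishes_of_check le_rfl hW.1 (hn ▸ trivial))
  generator := by
    rw [hperp]
    refine ⟨inf_le_right, fun Y hY => ?_⟩
    -- The pushout `M` of `ΩY ⟶ Q` and `ΩY ⟶ X` is an extension of `Y` by `X` and of `Z` by `Q`.
    obtain ⟨Q, k, p, h₁, hQ⟩ := syzygy_spec hP Y
    obtain ⟨X, Z, a, y, h₂, hX', hZ⟩ := hX.exists_conflation (hP := hP) hKS hE hf hs (syzygy hP Y)
    obtain ⟨M, i₂, p₁, i₁, p₂, h, h'⟩ := h₁.exists_pushout h₂
    exact ⟨X, M, i₂, p₁, h, ⟨fun V hV i => vanishes_middle_left hE h' (vanishes_of_proj hE hQ)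
      (hZ V hV i), hX.ext_closed _ _ h hX' hY⟩, hX'⟩

theorem IsCoresolving.rightPerp_leftPerp_inf (hKS : IsKrullSchmidt C) (hE : 𝓔.EnoughInj)
    (hX : 𝓔.IsCoresolving P) (hf : IsCovariantlyFinite P) (hs : ClosedUnderSummands P)
    (hn : 𝓔.check P n = ⊤) : rightPerp hP (leftPerp hP P ⊓ P) = P := by
  refine le_antisymm (fun Y hY => ?_) fun Y hY W hW i => hW.1 Y hY i
  -- Vanishing in degrees `≥ n` propagates downwards along conflations `W ⟶ T ⟶ W'`.
  have key : ∀ (k j : ℕ), n ≤ j + k → ∀ W, leftPerp hP P W → Vanishes hP j W Y := by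
    intro k
    induction k with
    | zero => exact fun j hj W hW => vanishes_of_check hj hW (hn ▸ trivial)
    | succ k ih =>
      intro j hj W hW
      obtain ⟨T, W', a, y, h, hT, hW'⟩ := hX.exists_conflation (hP := hP) hKS hE hf hs W
      refine vanishes_cocone_left hE h (hY T ⟨fun V hV i => ?_, hT⟩ j)
        (ih (j + 1) (by omega) W' hW')
      exact vanishes_middle_left hE h (hW V hV i) (hW' V hV i)
  obtain ⟨X, Z, a, y, h, hX', hZ⟩ := hX.exists_conflation (hP := hP) hKS hE hf hs Y
  obtain ⟨e⟩ := h.exists_split (key n 0 (by omega) Z hZ)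
  exact hs e hX'

end

/-! ### The correspondence -/

variable (𝓔) in
/-- The coresolving covariantly finite subcategories, closed under direct summands, by which every
object is coresolved in `n` steps. -/
def coresolvingClass (n : ℕ) : Set (ObjectProperty C) :=
  {X | 𝓔.IsCoresolving X ∧ IsCovariantlyFinite X ∧ ClosedUnderSummands X ∧ 𝓔.check X n = ⊤}

/-- The tilting half of the correspondence. -/
theorem tilting_correspondence (hKS : IsKrullSchmidt C) (hP : 𝓔.EnoughProj) (hE : 𝓔.EnoughInj)
    (n : ℕ) :
    Set.MapsTo (rightPerp hP) {P | IsTilting hP n P} (𝓔.coresolvingClass n) ∧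
      Set.MapsTo (fun X => leftPerp hP X ⊓ X) (𝓔.coresolvingClass n) {P | IsTilting hP n P} ∧
      Set.InvOn (fun X => leftPerp hP X ⊓ X) (rightPerp hP) {P | IsTilting hP n P}
        (𝓔.coresolvingClass n) := by
  refine ⟨fun P hT => ⟨rightPerp_isCoresolving, hT.isCovariantlyFinite hE,
    rightPerp_closedUnderSummands, hT.check_eq_top hE⟩, ?_, fun P hT => hT.leftPerp_inf_rightPerp,
    ?_⟩
  · rintro X ⟨hX, hf, hs, hn⟩
    exact hX.isTilting hKS hE hf hs hn (hX.rightPerp_leftPerp_inf hKS hE hf hs hn)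
  · rintro X ⟨hX, hf, hs, hn⟩
    exact hX.rightPerp_leftPerp_inf hKS hE hf hs hn

end Extriangulation

end

section

/-! ### Duality -/

variable {C : Type u} [Category.{v} C] [Preadditive C] [HasFiniteBiproducts C]

omit [HasFiniteBiproducts C] in
theorem isLocalRing_end_op {X : C} (h : IsLocalRing (End X)) : IsLocalRing (End (op X)) where
  exists_pair_ne := ⟨0, 1, fun h' => zero_ne_one (α := End X) (Quiver.Hom.op_inj h')⟩
  isUnit_or_isUnit_of_add_one {a b} hab := by
    rw [isUnit_iff_isIso, isUnit_iff_isIso]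
    refine (isIso_or_isIso_of_add_eq_id h (a := a.unop) (b := b.unop)
      (congrArg Quiver.Hom.unop hab)).imp ?_ ?_
    · intro; exact (isIso_unop_iff a).1 ‹_›
    · intro; exact (isIso_unop_iff b).1 ‹_›

theorem IsKrullSchmidt.op (h : IsKrullSchmidt C) : IsKrullSchmidt Cᵒᵖ := by
  intro X
  obtain ⟨m, F, hF, ⟨e⟩⟩ := h X.unop
  refine ⟨m, fun i => Opposite.op (F i), fun i => isLocalRing_end_op (hF i),
    ⟨⟨biproduct.lift fun i => (biproduct.ι F i ≫ e.inv).op,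
      biproduct.desc fun i => (e.hom ≫ biproduct.π F i).op, ?_, ?_⟩⟩⟩
  · rw [biproduct.lift_desc]
    apply Quiver.Hom.unop_inj
    have h := e.hom ≫= (biproduct.total (f := F) =≫ e.inv)
    simp only [Preadditive.comp_sum, Preadditive.sum_comp, Category.assoc, Category.id_comp,
      e.hom_inv_id] at h
    simpa [unop_sum] using h
  · ext i j
    by_cases hij : i = j
    · subst hij
      simp [← op_comp]
    · have h := biproduct.ι_π_ne F hij
      have h' := biproduct.ι_π_ne (fun i => Opposite.op (F i)) (Ne.symm hij)
      simp [← op_comp, h, h']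

namespace Extriangulation

theorem closedUnderSummands_op_iff {P : ObjectProperty C} :
    ClosedUnderSummands P.op ↔ ClosedUnderSummands P :=
  ⟨fun h {X Y _} e hZ => h (X := op X) (Y := op Y) (e.symm.op ≪≫ (biprodOp (op X) (op Y)).symm) hZ,
    fun h {_ _ _} e hZ => h (e.symm.unop ≪≫ (biprodOp _ _).symm.unop) hZ⟩

theorem isAdditiveSubcategory_op_iff {P : ObjectProperty C} :
    IsAdditiveSubcategory P.op ↔ IsAdditiveSubcategory P where
  mp h :=
    { iso_closed := fun e hX => h.iso_closed e.symm.op hX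
      zero_mem := fun hZ => h.zero_mem hZ.op
      sum_mem := fun {X Y} hX hY =>
        h.iso_closed (biprodOp (op X) (op Y)) (h.sum_mem (X := op X) (Y := op Y) hX hY) }
  mpr h :=
    { iso_closed := fun e hX => h.iso_closed e.symm.unop hX
      zero_mem := fun hZ => h.zero_mem hZ.unop
      sum_mem := fun {X Y} hX hY => h.iso_closed (biprodOp X Y).unop (h.sum_mem hX hY) }

omit [Preadditive C] [HasFiniteBiproducts C] in
theorem isCovariantlyFinite_op_iff {P : ObjectProperty C} :
    IsCovariantlyFinite P.op ↔ IsContravariantlyFinite P where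
  mp h A := by
    obtain ⟨Y, g, hY, hg⟩ := h (op A)
    refine ⟨Y.unop, g.unop, hY, fun X hX f => ?_⟩
    obtain ⟨k, hk⟩ := hg (op X) hX f.op
    exact ⟨k.unop, Quiver.Hom.op_inj hk⟩
  mpr h A := by
    obtain ⟨Y, g, hY, hg⟩ := h A.unop
    refine ⟨op Y, g.op, hY, fun X hX f => ?_⟩
    obtain ⟨k, hk⟩ := hg X.unop hX f.unop
    exact ⟨k.op, Quiver.Hom.unop_inj hk⟩

variable {𝓔 : Extriangulation.{w} C}

theorem opposite_proj : 𝓔.opposite.proj = 𝓔.inj.op := by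
  ext X
  exact proj_iff.trans ⟨fun h => inj_iff.2 fun D => h (op D), fun h A => inj_iff.1 h A.unop⟩

theorem opposite_inj : 𝓔.opposite.inj = 𝓔.proj.op := by
  ext X
  exact inj_iff.trans ⟨fun h => proj_iff.2 fun A => h (op A), fun h D => proj_iff.1 h D.unop⟩

theorem opposite_proj_op {I : C} (h : 𝓔.inj I) : 𝓔.opposite.proj (op I) :=
  proj_iff.2 fun A => inj_iff.1 h A.unop

theorem opposite_inj_op {P : C} (h : 𝓔.proj P) : 𝓔.opposite.inj (op P) :=
  inj_iff.2 fun D => proj_iff.1 h D.unop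

theorem EnoughInj.opposite (hE : 𝓔.EnoughInj) : 𝓔.opposite.EnoughProj := fun D =>
  let ⟨I, L, x, y, h, hI⟩ := hE D.unop
  ⟨op L, op I, y.op, x.op, h.op, opposite_proj_op hI⟩

theorem EnoughProj.opposite (hP : 𝓔.EnoughProj) : 𝓔.opposite.EnoughInj := fun A =>
  let ⟨K, P, x, y, h, hP'⟩ := hP A.unop
  ⟨op P, op K, y.op, x.op, h.op, opposite_inj_op hP'⟩

theorem opposite_check (P : ObjectProperty C) (n : ℕ) :
    𝓔.opposite.check P.op n = (𝓔.hat P n).op := by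
  induction n with
  | zero => rfl
  | succ n ih =>
    ext A
    refine ⟨fun ⟨T, K, x, y, h, hT, hK⟩ => ⟨K.unop, T.unop, y.unop, x.unop, h.unop, hT, ?_⟩,
      fun ⟨K, T, x, y, h, hT, hK⟩ => ⟨op T, op K, y.op, x.op, h.op, hT, ?_⟩⟩
    · rwa [ih] at hK
    · rwa [ih]

theorem opposite_hat (P : ObjectProperty C) (n : ℕ) :
    𝓔.opposite.hat P.op n = (𝓔.check P n).op := by
  induction n with
  | zero => rfl
  | succ n ih =>
    ext A
    refine ⟨fun ⟨K, T, x, y, h, hT, hK⟩ => ⟨T.unop, K.unop, y.unop, x.unop, h.unop, hT, ?_⟩,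
      fun ⟨T, K, x, y, h, hT, hK⟩ => ⟨op K, op T, y.op, x.op, h.op, hT, ?_⟩⟩
    · rwa [ih] at hK
    · rwa [ih]

theorem opposite_projDim (X : Cᵒᵖ) : 𝓔.opposite.projDim X = 𝓔.injDim X.unop := by
  simp only [projDim, injDim, opposite_proj, opposite_hat]
  rfl

/-- Higher extensions of the opposite extriangulation are computed by syzygies in either variable,
hence vanish together with those of the original one. -/
theorem opposite_vanishes_iff (hP : 𝓔.EnoughProj) (hE : 𝓔.EnoughInj) {i : ℕ} {X Y : Cᵒᵖ} :
    Vanishes hE.opposite i X Y ↔ Vanishes hP i Y.unop X.unop := by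
  induction i generalizing Y with
  | zero => exact Iff.rfl
  | succ i ih =>
    obtain ⟨Q, k, p, h, hQ⟩ := syzygy_spec hP Y.unop
    rw [vanishes_succ_iff_left hE h hQ]
    exact (vanishes_succ_iff_right h.op (opposite_inj_op hQ)).trans ih

theorem opposite_rightPerp (hP : 𝓔.EnoughProj) (hE : 𝓔.EnoughInj) (P : ObjectProperty C) :
    rightPerp hE.opposite P.op = (leftPerp hP P).op := by
  ext Y
  exact ⟨fun h X hX i => (opposite_vanishes_iff hP hE).1 (h (op X) hX i),
    fun h X hX i => (opposite_vanishes_iff hP hE).2 (h X.unop hX i)⟩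

theorem opposite_leftPerp (hP : 𝓔.EnoughProj) (hE : 𝓔.EnoughInj) (P : ObjectProperty C) :
    leftPerp hE.opposite P.op = (rightPerp hP P).op := by
  ext Y
  exact ⟨fun h X hX i => (opposite_vanishes_iff hP hE).1 (h (op X) hX i),
    fun h X hX i => (opposite_vanishes_iff hP hE).2 (h X.unop hX i)⟩

theorem opposite_isGeneratorFor_iff {P Q : ObjectProperty C} :
    𝓔.opposite.IsGeneratorFor P.op Q.op ↔ 𝓔.IsCogeneratorFor P Q := by
  refine and_congr ObjectProperty.op_monotone_iff ⟨fun h Y hY => ?_, fun h Y hY => ?_⟩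
  · obtain ⟨Y', X, x, y, hxy, hX, hY'⟩ := h (op Y) hY
    exact ⟨X.unop, Y'.unop, y.unop, x.unop, hxy.unop, hX, hY'⟩
  · obtain ⟨X, Y', x, y, hxy, hX, hY'⟩ := h Y.unop hY
    exact ⟨op Y', op X, y.op, x.op, hxy.op, hX, hY'⟩

theorem opposite_isTilting_iff (hP : 𝓔.EnoughProj) (hE : 𝓔.EnoughInj) {n : ℕ}
    {P : ObjectProperty C} : IsTilting hE.opposite n P.op ↔ IsCotilting hP n P where
  mp h :=
    { additive := isAdditiveSubcategory_op_iff.1 h.additive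
      summands := closedUnderSummands_op_iff.1 h.summands
      injDim_le := fun X hX => opposite_projDim (op X) ▸ h.projDim_le (op X) hX
      cogenerator := opposite_isGeneratorFor_iff.1 (opposite_rightPerp hP hE P ▸ h.generator) }
  mpr h :=
    { additive := isAdditiveSubcategory_op_iff.2 h.additive
      summands := closedUnderSummands_op_iff.2 h.summands
      projDim_le := fun X hX => opposite_projDim X ▸ h.injDim_le X.unop hX
      generator := by
        rw [opposite_rightPerp hP hE P]
        exact opposite_isGeneratorFor_iff.2 h.cogenerator }

theorem opposite_isCoresolving_iff {P : ObjectProperty C} :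
    𝓔.opposite.IsCoresolving P.op ↔ 𝓔.IsResolving P where
  mp h :=
    { additive := isAdditiveSubcategory_op_iff.1 h.additive
      proj_le := ObjectProperty.op_monotone_iff.1 (opposite_inj (𝓔 := 𝓔) ▸ h.inj_le)
      ext_closed := fun _ _ hxy hA hD => h.ext_closed _ _ hxy.op hD hA
      cocone_closed := fun _ _ hxy hB hD => h.cone_closed _ _ hxy.op hD hB }
  mpr h :=
    { additive := isAdditiveSubcategory_op_iff.2 h.additive
      inj_le := opposite_inj (𝓔 := 𝓔) ▸ ObjectProperty.op_monotone h.proj_le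
      ext_closed := fun _ _ hxy hA hD => h.ext_closed _ _ hxy.unop hD hA
      cone_closed := fun _ _ hxy hA hB => h.cocone_closed _ _ hxy.unop hB hA }

variable (𝓔) in
/-- The resolving contravariantly finite subcategories, closed under direct summands, by which every
object is resolved in `n` steps. -/
def resolvingClass (n : ℕ) : Set (ObjectProperty C) :=
  {X | 𝓔.IsResolving X ∧ IsContravariantlyFinite X ∧ ClosedUnderSummands X ∧ 𝓔.hat X n = ⊤}

theorem op_mem_coresolvingClass_iff {n : ℕ} {P : ObjectProperty C} :
    P.op ∈ 𝓔.opposite.coresolvingClass n ↔ P ∈ 𝓔.resolvingClass n := by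
  refine and_congr opposite_isCoresolving_iff (and_congr isCovariantlyFinite_op_iff
    (and_congr closedUnderSummands_op_iff ?_))
  rw [opposite_check]
  exact ObjectProperty.op_injective_iff (Q := ⊤)

/-- The cotilting half of the correspondence, which is the tilting half for the opposite
extriangulation. -/
theorem cotilting_correspondence (hKS : IsKrullSchmidt C) (hP : 𝓔.EnoughProj)
    (hE : 𝓔.EnoughInj) (n : ℕ) :
    Set.MapsTo (leftPerp hP) {P | IsCotilting hP n P} (𝓔.resolvingClass n) ∧
      Set.MapsTo (fun X => rightPerp hP X ⊓ X) (𝓔.resolvingClass n) {P | IsCotilting hP n P} ∧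
      Set.InvOn (fun X => rightPerp hP X ⊓ X) (leftPerp hP) {P | IsCotilting hP n P}
        (𝓔.resolvingClass n) := by
  obtain ⟨h₁, h₂, h₃, h₄⟩ := tilting_correspondence hKS.op hE.opposite hP.opposite n
  have hinf (X : ObjectProperty C) : leftPerp hE.opposite X.op ⊓ X.op =
      (rightPerp hP X ⊓ X).op := by
    rw [opposite_leftPerp hP hE]
    rfl
  refine ⟨fun P hT => ?_, fun X hX => ?_, fun P hT => ?_, fun X hX => ?_⟩
  · have h := h₁ ((opposite_isTilting_iff hP hE).2 hT)
    rwa [opposite_rightPerp hP hE, op_mem_coresolvingClass_iff] at h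
  · have h := h₂ (op_mem_coresolvingClass_iff.2 hX)
    exact (opposite_isTilting_iff hP hE).1 (hinf X ▸ h)
  · have h := h₃ ((opposite_isTilting_iff hP hE).2 hT)
    simp only [opposite_rightPerp hP hE, hinf] at h
    exact ObjectProperty.op_injective h
  · have h := h₄ (op_mem_coresolvingClass_iff.2 hX)
    simp only [opposite_rightPerp hP hE, hinf] at h
    exact ObjectProperty.op_injective h

end Extriangulation

end

theorem theorem4p15 {C : Type u} [Category.{v} C] [Preadditive C] [HasFiniteBiproducts C]
    (hKS : IsKrullSchmidt C) (𝓔 : Extriangulation.{w} C)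
    (hP : 𝓔.EnoughProj) (hI : 𝓔.EnoughInj) (n : ℕ) :
    (Set.BijOn (fun P : ObjectProperty C => Extriangulation.rightPerp hP P)
        {P | Extriangulation.IsTilting hP n P}
        {X | 𝓔.IsCoresolving X ∧ IsCovariantlyFinite X ∧ ClosedUnderSummands X ∧
          𝓔.check X n = ⊤} ∧
      Set.BijOn (fun X : ObjectProperty C => Extriangulation.leftPerp hP X ⊓ X)
        {X | 𝓔.IsCoresolving X ∧ IsCovariantlyFinite X ∧ ClosedUnderSummands X ∧
          𝓔.check X n = ⊤}
        {P | Extriangulation.IsTilting hP n P} ∧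
      Set.InvOn (fun X : ObjectProperty C => Extriangulation.leftPerp hP X ⊓ X)
        (fun P : ObjectProperty C => Extriangulation.rightPerp hP P)
        {P | Extriangulation.IsTilting hP n P}
        {X | 𝓔.IsCoresolving X ∧ IsCovariantlyFinite X ∧ ClosedUnderSummands X ∧
          𝓔.check X n = ⊤}) ∧
    (Set.BijOn (fun P : ObjectProperty C => Extriangulation.leftPerp hP P)
        {P | Extriangulation.IsCotilting hP n P}
        {X | 𝓔.IsResolving X ∧ IsContravariantlyFinite X ∧ ClosedUnderSummands X ∧
          𝓔.hat X n = ⊤} ∧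
      Set.BijOn (fun X : ObjectProperty C => Extriangulation.rightPerp hP X ⊓ X)
        {X | 𝓔.IsResolving X ∧ IsContravariantlyFinite X ∧ ClosedUnderSummands X ∧
          𝓔.hat X n = ⊤}
        {P | Extriangulation.IsCotilting hP n P} ∧
      Set.InvOn (fun X : ObjectProperty C => Extriangulation.rightPerp hP X ⊓ X)
        (fun P : ObjectProperty C => Extriangulation.leftPerp hP P)
        {P | Extriangulation.IsCotilting hP n P}
        {X | 𝓔.IsResolving X ∧ IsContravariantlyFinite X ∧ ClosedUnderSummands X ∧
          𝓔.hat X n = ⊤}) := by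
  obtain ⟨h₁, h₂, h₃⟩ := Extriangulation.tilting_correspondence hKS hP hI n
  obtain ⟨k₁, k₂, k₃⟩ := Extriangulation.cotilting_correspondence hKS hP hI n
  exact ⟨⟨h₃.bijOn h₁ h₂, h₃.symm.bijOn h₂ h₁, h₃⟩, k₃.bijOn k₁ k₂, k₃.symm.bijOn k₂ k₁, k₃⟩
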